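/- Let $X$ be a proper geodesic metric space with base point $o$. **Conventions.** For an interval $I\subseteq\mathbb R$ and $L\ge 1$, $A\ge 0$, a map $c:I\to X$ is an $(L,A)$-quasi-geodesic if $\frac1L|s-t|-A\le d(c(s),c(t))\le L|s-t|+A$ for all $s,t\in I$. A function $\rho$ on $[0,\infty)$ is sublinear if it is non-decreasing, eventually non-negative and $\rho(r)/r\to 0$ as $r\to\infty$. For $Z\subseteq X$ let $\pi_Z(x)=\{z\in Z: d(x,z)=d(x,Z)\}$. The set $Z$ is contracting if $\pi_Z(x)\neq\emptyset$ for all $x\in X$ and there is a sublinear $\rho$ such that $d(x,y)\le d(x,Z)$ implies $\operatorname{diam}(\pi_Z(x)\cup\pi_Z(y))\le\rho(d(x,Z))$ for all $x,y\in X$. The contracting boundary $\partial_cX$ is the set of quasi-geodesic rays $[0,\infty)\to X$ starting at $o$ with contracting image, modulo finite Hausdorff distance. For $\zeta\in\partial_cX$ let $$\rho_\zeta(r)=\sup\operatorname{diam}\big(\pi_\alpha(x)\cup\pi_\alpha(y)\big),$$ the supremum being over geodesic rays $\alpha\in\zeta$ and $x,y\in X$ with $d(x,y)\le d(x,\alpha)\le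 r$; put $$\kappa(\rho,L,A)=\max\{3A,\,3L^2,\,1+\inf\{R>0: 3L^2\rho(r)\le r\text{ for all }r\ge R\}\},$$ fix a geodesic ray $\alpha^\zeta\in\zeta$, and let $N^c_ro=\{x\in X:d(o,x)\ge r\}$. Let $\bar X=X\cup\partial_cX$. For $\zeta\in\partial_cX$ and $r\ge1$ let $\bar U(\zeta,r)\subseteq\bar X$ be the set consisting of - the points $\eta\in\partial_cX$ such that $d(\beta,\alpha^\zeta\cap N^c_ro)\le\kappa(\rho_\zeta,L,A)$ for all $L\ge1$, $A\ge0$ and all continuous $(L,A)$-quasi-geodesic rays $\beta\in\eta$, and - the points $x\in X$ such that $d(\beta,\alpha^\zeta\cap N^c_ro)\le\kappa(\rho_\zeta,L,A)$ for all $L\ge1$, $A\ge0$ and all continuous $(L,A)$-quasi-geodesic segments $\beta$ with endpoints $o$ and $x$. Topologize $\bar X$ by taking the metric balls as basic neighbourhoods of the points of $X$, and the sets $\bar U(\zeta,r)$, $r\ge1$, as basic neighbourhoods of $\zeta\in\partial_cX$; that is, $W\subseteq\bar X$ is open if and only if each point of $W$ has a basic neighbourhood contained in $W$. A continuous quasi-geodesic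 defined on an interval that is unbounded in one direction has endpoint $\zeta\in\partial_cX$ in that direction if its restriction to a half-line in that direction is at finite Hausdorff distance from the rays in $\zeta$. **Theorem.** Let $\gamma_n$ ($n\in\mathbb N$) be continuous $(3,0)$-quasi-geodesics, defined on intervals $I_n\subseteq\mathbb R$ (compact, half-infinite or all of $\mathbb R$), with endpoints $x_n,y_n\in X\cup\partial_cX$. Suppose that $x_n\to\zeta$ and $y_n\to\eta$ in $X\cup\partial_cX$ with $\zeta\ne\eta$. Then there is a bounded set $B\subseteq X$ that meets the image of $\gamma_n$ for every $n$. -/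

import Mathlib

open Filter Topology

namespace MorseBoundary

/-- A geodesic space: any two points are joined by a geodesic segment. -/
def IsGeodesicSpace (X : Type*) [MetricSpace X] : Prop :=
  ∀ x y : X, ∃ c : ℝ → X, c 0 = x ∧ c (dist x y) = y ∧
    ∀ s ∈ Set.Icc 0 (dist x y), ∀ t ∈ Set.Icc 0 (dist x y), dist (c s) (c t) = |s - t|

/-- `c`, restricted to `I ⊆ ℝ`, is a `(K, ε)`-quasi-isometric embedding. Values of `c` off `I` are
irrelevant. When `I` is an interval this says that `c` is a `(K, ε)`-quasi-geodesic. -/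
def IsQuasiGeodesicOn {X : Type*} [MetricSpace X] (K ε : ℝ) (c : ℝ → X) (I : Set ℝ) : Prop :=
  ∀ s ∈ I, ∀ t ∈ I,
    1 / K * |s - t| - ε ≤ dist (c s) (c t) ∧ dist (c s) (c t) ≤ K * |s - t| + ε

/-- Sublinear functions, on `[0, ∞)`. -/
def IsSublinear (ρ : ℝ → ℝ) : Prop :=
  MonotoneOn ρ (Set.Ici 0) ∧ (∀ᶠ r in atTop, 0 ≤ ρ r) ∧
    Tendsto (fun r => ρ r / r) atTop (𝓝 0)

/-- Closest point projection to `Z`. -/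
def proj {X : Type*} [MetricSpace X] (Z : Set X) (x : X) : Set X :=
  {z ∈ Z | dist x z = Metric.infDist x Z}

/-- `Z` is `ρ`-contracting. -/
def IsContractingWith {X : Type*} [MetricSpace X] (ρ : ℝ → ℝ) (Z : Set X) : Prop :=
  ∀ x y : X, dist x y ≤ Metric.infDist x Z →
    Metric.diam (proj Z x ∪ proj Z y) ≤ ρ (Metric.infDist x Z)

/-- `Z` is contracting. The first clause says that the closest point projection is defined
everywhere; in a proper space it means that `Z` is non-empty and closed. Without it a set
having no closest points (an open strip in the plane, say) would be contracting vacuously. -/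
def IsContracting {X : Type*} [MetricSpace X] (Z : Set X) : Prop :=
  (∀ x, (proj Z x).Nonempty) ∧ ∃ ρ, IsSublinear ρ ∧ IsContractingWith ρ Z

/-- Contracting quasi-geodesic rays `[0, ∞) → X` based at `o` (not necessarily continuous). -/
structure Ray (X : Type*) [MetricSpace X] (o : X) where
  toFun : ℝ → X
  base : toFun 0 = o
  quasiGeodesic : ∃ K ε : ℝ, 1 ≤ K ∧ 0 ≤ ε ∧ IsQuasiGeodesicOn K ε toFun (Set.Ici 0)
  contracting : IsContracting (toFun '' Set.Ici 0)

/-- The image of a ray. -/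
def Ray.image {X : Type*} [MetricSpace X] {o : X} (β : Ray X o) : Set X :=
  β.toFun '' Set.Ici 0

/-- The ray is geodesic. -/
def Ray.IsGeodesic {X : Type*} [MetricSpace X] {o : X} (β : Ray X o) : Prop :=
  ∀ s ∈ Set.Ici (0 : ℝ), ∀ t ∈ Set.Ici (0 : ℝ), dist (β.toFun s) (β.toFun t) = |s - t|

/-- Hausdorff equivalence of rays: the images are at finite Hausdorff distance. -/
instance raySetoid (X : Type*) [MetricSpace X] (o : X) : Setoid (Ray X o) where
  r α β := Metric.hausdorffEDist α.image β.image ≠ ⊤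
  iseqv :=
    { refl := fun α => by simp
      symm := fun {α β} h => by rwa [Metric.hausdorffEDist_comm]
      trans := fun {α β γ} h h' =>
        ne_top_of_le_ne_top (ENNReal.add_ne_top.2 ⟨h, h'⟩) Metric.hausdorffEDist_triangle }

/-- The contracting boundary of `X`, with base point `o`. -/
def Boundary (X : Type*) [MetricSpace X] (o : X) : Type _ := Quotient (raySetoid X o)

/-- The boundary point of a ray. -/
def Ray.toBoundary {X : Type*} [MetricSpace X] {o : X} (β : Ray X o) : Boundary X o :=
  Quotient.mk (raySetoid X o) β

/-- The sublinear function `ρ_ζ`: the supremum of `diam (π_α(x) ∪ π_α(y))` over all geodesic rays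
`α ∈ ζ` and all points `x`, `y` with `d(x, y) ≤ d(x, α) ≤ r`. (These diameters are at most
`4 r`.) -/
noncomputable def rhoOf {X : Type*} [MetricSpace X] {o : X} (ζ : Boundary X o) (r : ℝ) : ℝ :=
  sSup {D : ℝ | ∃ α : Ray X o, α.IsGeodesic ∧ α.toBoundary = ζ ∧ ∃ x y : X,
    dist x y ≤ Metric.infDist x α.image ∧ Metric.infDist x α.image ≤ r ∧
    D = Metric.diam (proj α.image x ∪ proj α.image y)}

/-- The constant `κ(ρ, L, A)`. -/
noncomputable def kappa (ρ : ℝ → ℝ) (L A : ℝ) : ℝ :=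
  max (3 * A) (max (3 * L ^ 2)
    (1 + sInf {R : ℝ | 0 < R ∧ ∀ r, R ≤ r → 3 * L ^ 2 * ρ r ≤ r}))

open Classical in
/-- A fixed (arbitrarily chosen) geodesic ray `α^ζ` in the class `ζ`. The last alternative only
serves to make the definition total. -/
noncomputable def geodesicRay {X : Type*} [MetricSpace X] {o : X} (ζ : Boundary X o) : Ray X o :=
  if h : ∃ α : Ray X o, α.IsGeodesic ∧ α.toBoundary = ζ then h.choose else Quotient.out ζ

/-- The distance between two sets (infinite when one of them is empty). -/
noncomputable def setDist {X : Type*} [MetricSpace X] (S T : Set X) : ENNReal :=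
  ⨅ x ∈ S, Metric.infEDist x T

/-- The part `α^ζ ∩ N^c_r o` of the ray `α^ζ` at distance at least `r` from the base point. -/
noncomputable def farPart {X : Type*} [MetricSpace X] {o : X} (ζ : Boundary X o) (r : ℝ) : Set X :=
  (geodesicRay ζ).image ∩ {x | r ≤ dist o x}

/-- The set `U(ζ, r)` of boundary points. -/
def boundaryNhd {X : Type*} [MetricSpace X] {o : X} (ζ : Boundary X o) (r : ℝ) :
    Set (Boundary X o) :=
  {η | ∀ L A : ℝ, 1 ≤ L → 0 ≤ A → ∀ β : Ray X o, β.toBoundary = η →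
    ContinuousOn β.toFun (Set.Ici 0) → IsQuasiGeodesicOn L A β.toFun (Set.Ici 0) →
    setDist β.image (farPart ζ r) ≤ ENNReal.ofReal (kappa (rhoOf ζ) L A)}

/-- The set of points `x ∈ X` such that every continuous `(L, A)`-quasi-geodesic segment from `o`
to `x` comes `κ(ρ_ζ, L, A)`-close to `α^ζ ∩ N^c_r o`. -/
def interiorNhd {X : Type*} [MetricSpace X] {o : X} (ζ : Boundary X o) (r : ℝ) : Set X :=
  {x | ∀ L A : ℝ, 1 ≤ L → 0 ≤ A → ∀ (T : ℝ) (c : ℝ → X), 0 ≤ T → c 0 = o → c T = x →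
    ContinuousOn c (Set.Icc 0 T) → IsQuasiGeodesicOn L A c (Set.Icc 0 T) →
    setDist (c '' Set.Icc 0 T) (farPart ζ r) ≤ ENNReal.ofReal (kappa (rhoOf ζ) L A)}

/-- The bordification `X ∪ ∂_c X`. -/
inductive Bordification (X : Type*) [MetricSpace X] (o : X)
  | inner (x : X) : Bordification X o
  | ideal (ζ : Boundary X o) : Bordification X o

/-- The set `Ū(ζ, r)`: the union of `U(ζ, r)` with the corresponding points of `X`. -/
def bordNhd {X : Type*} [MetricSpace X] {o : X} (ζ : Boundary X o) (r : ℝ) :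
    Set (Bordification X o) :=
  Bordification.inner '' interiorNhd ζ r ∪ Bordification.ideal '' boundaryNhd ζ r

theorem setDist_anti {X : Type*} [MetricSpace X] (S : Set X) {T T' : Set X} (h : T ⊆ T') :
    setDist S T' ≤ setDist S T :=
  iInf₂_mono fun _ _ => Metric.infEDist_anti h

theorem farPart_anti {X : Type*} [MetricSpace X] {o : X} (ζ : Boundary X o) {r r' : ℝ}
    (h : r ≤ r') : farPart ζ r' ⊆ farPart ζ r :=
  fun _ hx => ⟨hx.1, h.trans hx.2⟩

theorem bordNhd_anti {X : Type*} [MetricSpace X] {o : X} (ζ : Boundary X o) {r r' : ℝ}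
    (h : r ≤ r') : bordNhd ζ r' ⊆ bordNhd ζ r := by
  rintro _ (⟨x, hx, rfl⟩ | ⟨η, hη, rfl⟩)
  · refine Or.inl ⟨x, fun L A hL hA T c hT h0 hx' hc hq => ?_, rfl⟩
    exact (setDist_anti _ (farPart_anti ζ h)).trans (hx L A hL hA T c hT h0 hx' hc hq)
  · refine Or.inr ⟨η, fun L A hL hA β hβ hc hq => ?_, rfl⟩
    exact (setDist_anti _ (farPart_anti ζ h)).trans (hη L A hL hA β hβ hc hq)

/-- The topology of the bordification: metric balls are basic neighbourhoods of the points of `X`,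
the sets `Ū(ζ, r)`, `r ≥ 1`, are basic neighbourhoods of `ζ ∈ ∂_c X`. -/
instance bordTopology (X : Type*) [MetricSpace X] (o : X) :
    TopologicalSpace (Bordification X o) where
  IsOpen W :=
    (∀ x, Bordification.inner x ∈ W →
      ∃ r > 0, Bordification.inner '' Metric.ball x r ⊆ W) ∧
    (∀ ζ, Bordification.ideal ζ ∈ W → ∃ r : ℝ, 1 ≤ r ∧ bordNhd ζ r ⊆ W)
  isOpen_univ := ⟨fun _ _ => ⟨1, one_pos, Set.subset_univ _⟩,
    fun _ _ => ⟨1, le_rfl, Set.subset_univ _⟩⟩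
  isOpen_inter := by
    rintro V W ⟨hV, hV'⟩ ⟨hW, hW'⟩
    refine ⟨fun x hx => ?_, fun ζ hζ => ?_⟩
    · obtain ⟨r, hr, h⟩ := hV x hx.1
      obtain ⟨s, hs, h'⟩ := hW x hx.2
      exact ⟨min r s, lt_min hr hs, Set.subset_inter
        ((Set.image_mono (Metric.ball_subset_ball (min_le_left r s))).trans h)
        ((Set.image_mono (Metric.ball_subset_ball (min_le_right r s))).trans h')⟩
    · obtain ⟨r, hr, h⟩ := hV' ζ hζ.1
      obtain ⟨s, hs, h'⟩ := hW' ζ hζ.2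
      exact ⟨max r s, hr.trans (le_max_left r s), Set.subset_inter
        ((bordNhd_anti ζ (le_max_left r s)).trans h)
        ((bordNhd_anti ζ (le_max_right r s)).trans h')⟩
  isOpen_sUnion := by
    intro 𝒲 h
    refine ⟨fun x ⟨W, hW, hx⟩ => ?_, fun ζ ⟨W, hW, hζ⟩ => ?_⟩
    · obtain ⟨r, hr, h'⟩ := (h W hW).1 x hx
      exact ⟨r, hr, h'.trans (Set.subset_sUnion_of_mem hW)⟩
    · obtain ⟨r, hr, h'⟩ := (h W hW).2 ζ hζ
      exact ⟨r, hr, h'.trans (Set.subset_sUnion_of_mem hW)⟩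

/-- The set `S` (the image of a ray) is asymptotic to `ζ`: it is at finite Hausdorff distance
from the image of a ray of the class `ζ`. -/
def AsymptoticTo {X : Type*} [MetricSpace X] {o : X} (S : Set X) (ζ : Boundary X o) : Prop :=
  ∃ β : Ray X o, β.toBoundary = ζ ∧ Metric.hausdorffEDist S β.image ≠ ⊤

/-- The left (initial) endpoint in `X ∪ ∂_c X` of the path `c` defined on the interval `I`: the
value at the left end of `I` if there is one, and the boundary point to which a ray
`c |_{(-∞, a]}` is asymptotic if `I` is unbounded below. -/
def HasLeftEndpoint {X : Type*} [MetricSpace X] {o : X} (c : ℝ → X) (I : Set ℝ) :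
    Bordification X o → Prop
  | .inner x => ∃ a, IsLeast I a ∧ c a = x
  | .ideal ζ => ¬ BddBelow I ∧ ∃ a ∈ I, AsymptoticTo (c '' (I ∩ Set.Iic a)) ζ

/-- The right (terminal) endpoint in `X ∪ ∂_c X` of the path `c` defined on the interval `I`. -/
def HasRightEndpoint {X : Type*} [MetricSpace X] {o : X} (c : ℝ → X) (I : Set ℝ) :
    Bordification X o → Prop
  | .inner x => ∃ b, IsGreatest I b ∧ c b = x
  | .ideal ζ => ¬ BddAbove I ∧ ∃ b ∈ I, AsymptoticTo (c '' (I ∩ Set.Ici b)) ζ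

end MorseBoundary

namespace MorseBoundary

variable {X : Type*} [MetricSpace X]

/-! If one of the limits is a point p of X, the corresponding endpoints lie on the paths and are
eventually within 1 of p, since the unit ball about p is open in the bordification. Finitely many
exceptional n cost finitely many extra points of B.

The substance is the case of two boundary points ζ ≠ η (`exists_dist_le_of_ne`). Choose a point
γ(t₀) of the path almost closest to o. A geodesic g from o to γ(t₀), continued along either half of
γ, is a (7, 1)-quasi-geodesic (`concat_closest_spec`). Its two versions end deep in neighbourhoods
of ζ and η, so they pass uniformly close to α^ζ(u) and α^η(u), for a height u fixed in advance. If
γ(t₀) were far from o, so would be all of γ, and both passages would happen on the common part g. A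
geodesic from o passing close to both points at height u makes them uniformly close to each other,
which fails for a suitable u because ζ ≠ η. Hence d(o, γ(t₀)) is bounded independently of n.

The geometric input is that along a path staying outside the κ-neighbourhood of a contracting set
the closest point projection moves too slowly to keep up with a quasi-geodesic, so such excursions
are short (`length_le_of_excursion`). This gives the Morse property, geodesic representatives of
boundary points, the sublinearity of ρ_ζ (`rhoOf_spec`) and fellow travelling
(`exists_dist_le_fellowBound`).

The topological input is that Ū(ζ, r) really is a neighbourhood of ζ (`bordNhd_mem_nhds`); the
definition of the open sets does not give this. One needs that a point ω of U(ζ, R), with R large,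
has some Ū(ω, R') inside Ū(ζ, r). A quasi-geodesic that gets close to α^ω far out is cut and spliced
to the tail of α^ω, giving a ray in the class ω with controlled constants (`exists_ray_extension`).
This ray passes near α^ζ because ω ∈ U(ζ, R), and it does so before the splice. Only constants with
κ(ρ_ζ, L, A) < r matter, so L and A are bounded by r and all estimates are uniform. -/

theorem isBounded_proj (Z : Set X) (x : X) : Bornology.IsBounded (proj Z x) :=
  (Metric.isBounded_closedBall (x := x) (r := Metric.infDist x Z)).subset
    fun z hz => by rw [Metric.mem_closedBall, dist_comm]; exact hz.2.le

theorem IsContractingWith.dist_le {ρ : ℝ → ℝ} {Z : Set X} (h : IsContractingWith ρ Z)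
    {x y p q : X} (hxy : dist x y ≤ Metric.infDist x Z) (hp : p ∈ proj Z x) (hq : q ∈ proj Z y) :
    dist p q ≤ ρ (Metric.infDist x Z) :=
  (Metric.dist_le_diam_of_mem ((isBounded_proj Z x).union (isBounded_proj Z y))
    (Or.inl hp) (Or.inr hq)).trans (h x y hxy)

theorem infDist_le_infDist_add (Z : Set X) (x y : X) :
    Metric.infDist x Z ≤ Metric.infDist y Z + dist x y :=
  Metric.infDist_le_infDist_add_dist

/-! ### Excursions from a contracting set and the Morse property -/

/-- The properties of the constant `κ(ρ, L, A)` that are used for contracting sets. -/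
structure Admissible (ρ : ℝ → ℝ) (L A κ : ℝ) : Prop where
  additive : 3 * A ≤ κ
  multiplicative : 3 * L ^ 2 ≤ κ
  sublinear : ∀ r, κ ≤ r → 3 * L ^ 2 * ρ r ≤ r

theorem Admissible.mono {ρ : ℝ → ℝ} {L A κ κ' : ℝ} (h : Admissible ρ L A κ) (h' : κ ≤ κ') :
    Admissible ρ L A κ' :=
  ⟨h.1.trans h', h.2.trans h', fun r hr => h.3 r (h'.trans hr)⟩

theorem IsQuasiGeodesicOn.mono {L A : ℝ} {c : ℝ → X} {I J : Set ℝ}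
    (h : IsQuasiGeodesicOn L A c I) (hJ : J ⊆ I) : IsQuasiGeodesicOn L A c J :=
  fun s hs t ht => h s (hJ hs) t (hJ ht)

theorem IsQuasiGeodesicOn.weaken {L A L' A' : ℝ} {c : ℝ → X} {I : Set ℝ}
    (h : IsQuasiGeodesicOn L A c I) (hL : 1 ≤ L) (hL' : L ≤ L') (hA : A ≤ A') :
    IsQuasiGeodesicOn L' A' c I := fun s hs t ht => by
  obtain ⟨h1, h2⟩ := h s hs t ht
  have h3 : 1 / L' * |s - t| ≤ 1 / L * |s - t| :=
    mul_le_mul_of_nonneg_right (one_div_le_one_div_of_le (by linarith) hL') (abs_nonneg _)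
  have h4 : L * |s - t| ≤ L' * |s - t| := mul_le_mul_of_nonneg_right hL' (abs_nonneg _)
  exact ⟨by linarith, by linarith⟩

theorem IsQuasiGeodesicOn.le_of_le {L A : ℝ} {c : ℝ → X} {I : Set ℝ}
    (h : IsQuasiGeodesicOn L A c I) (hL : 1 ≤ L) {s t : ℝ} (hs : s ∈ I) (ht : t ∈ I) (hst : s ≤ t) :
    t - s ≤ L * (dist (c s) (c t) + A) ∧ dist (c s) (c t) ≤ L * (t - s) + A := by
  obtain ⟨h1, h2⟩ := h s hs t ht
  rw [abs_sub_comm, abs_of_nonneg (sub_nonneg.2 hst)] at h1 h2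
  refine ⟨?_, h2⟩
  have hL0 : 0 < L := by linarith
  have : 1 / L * (t - s) ≤ dist (c s) (c t) + A := by linarith
  calc t - s = L * (1 / L * (t - s)) := by field_simp
    _ ≤ _ := mul_le_mul_of_nonneg_left this hL0.le

theorem continuousOn_infDist {c : ℝ → X} {I : Set ℝ} (hc : ContinuousOn c I) (Z : Set X) :
    ContinuousOn (fun t => Metric.infDist (c t) Z) I :=
  (Metric.continuous_infDist_pt Z).comp_continuousOn hc

/-- Cut the path into jumps, each as long as the distance of its starting point from Z. A jump of
length d moves the projection by at most ρ(d) ≤ d / (3 L²) and takes time at least 2 d / (3 L), so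
the projection has speed at most 1 / (2 L). The term with M pays for the last, incomplete jump. -/
theorem dist_proj_le_of_excursion {ρ : ℝ → ℝ} {Z : Set X} (hZ : ∀ x, (proj Z x).Nonempty)
    (hρ : IsContractingWith ρ Z) {L A κ : ℝ} (hL : 1 ≤ L) (hκ : Admissible ρ L A κ)
    {c : ℝ → X} {b M : ℝ} (n : ℕ) : ∀ a, a ≤ b → b - a ≤ n → ContinuousOn c (Set.Icc a b) →
    IsQuasiGeodesicOn L A c (Set.Icc a b) → (∀ t ∈ Set.Icc a b, κ ≤ Metric.infDist (c t) Z) →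
    (∀ t ∈ Set.Icc a b, Metric.infDist (c t) Z ≤ M) →
    ∀ p ∈ proj Z (c a), ∀ q ∈ proj Z (c b),
      dist p q ≤ (b - a) / (2 * L) + M / (3 * L ^ 2) := by
  have hL0 : 0 < L := by linarith
  induction n with
  | zero =>
    intro a hab hn _ _ hfar hM p hp q hq
    have : a = b := by push_cast at hn; linarith
    subst this
    have ha : a ∈ Set.Icc a a := ⟨le_rfl, le_rfl⟩
    have h1 := hρ.dist_le (by simpa using Metric.infDist_nonneg) hp hq
    have h2 := hκ.sublinear _ (hfar a ha)
    rw [sub_self, zero_div, zero_add, le_div_iff₀ (by positivity)]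
    nlinarith [hM a ha, sq_nonneg L]
  | succ n ih =>
    intro a hab hn hc hq hfar hM p hp q hq'
    have ha : a ∈ Set.Icc a b := ⟨le_rfl, hab⟩
    have h2 := hκ.sublinear _ (hfar a ha)
    set d := Metric.infDist (c a) Z with hd
    by_cases h : dist (c a) (c b) ≤ d
    · have h1 := hρ.dist_le h hp hq'
      have : dist p q ≤ M / (3 * L ^ 2) := by
        rw [le_div_iff₀ (by positivity)]
        nlinarith [hM a ha, sq_nonneg L]
      have : 0 ≤ (b - a) / (2 * L) := div_nonneg (by linarith) (by positivity)
      linarith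
    · push Not at h
      have hcont : ContinuousOn (fun t => dist (c a) (c t)) (Set.Icc a b) :=
        (continuous_const.dist continuous_id).comp_continuousOn hc
      obtain ⟨t, ht, hdt⟩ := intermediate_value_Icc hab hcont
        (show d ∈ Set.Icc (dist (c a) (c a)) (dist (c a) (c b)) from
          ⟨by simpa using Metric.infDist_nonneg, h.le⟩)
      simp only at hdt
      obtain ⟨z, hz⟩ := hZ (c t)
      have h1 := hρ.dist_le hdt.le hp hz
      have h3 := (hq.le_of_le hL ha ht ht.1).2
      -- The additive error is at most d / 3. Together with d ≥ 3 L² this also makes each jump last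
      -- at least time 1, so the induction on the length terminates.
      have h4 : 2 * d ≤ 3 * L * (t - a) := by linarith [hκ.additive, hfar a ha]
      have h5 : 1 ≤ t - a := by
        have := hκ.multiplicative
        have := hfar a ha
        nlinarith
      have hsub : Set.Icc t b ⊆ Set.Icc a b := Set.Icc_subset_Icc_left ht.1
      have h6 := ih t ht.2 (by push_cast at hn; linarith) (hc.mono hsub) (hq.mono hsub)
        (fun s hs => hfar s (hsub hs)) (fun s hs => hM s (hsub hs)) z hz q hq'
      have h7 : dist p z ≤ (t - a) / (2 * L) := by
        rw [le_div_iff₀ (by positivity)]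
        have : 3 * L ^ 2 * dist p z ≤ d := (mul_le_mul_of_nonneg_left h1 (by positivity)).trans h2
        have : L * (6 * L * dist p z) ≤ L * (3 * (t - a)) := by nlinarith
        linarith [le_of_mul_le_mul_left this hL0]
      have h8 : (b - a) / (2 * L) = (t - a) / (2 * L) + (b - t) / (2 * L) := by ring
      linarith [dist_triangle p z q]

/-- A continuous quasi-geodesic that stays outside the `κ`-neighbourhood of a contracting set has
length bounded linearly in terms of the distances of its endpoints from the set. -/
theorem length_le_of_excursion {ρ : ℝ → ℝ} {Z : Set X} (hZ : ∀ x, (proj Z x).Nonempty)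
    (hρ : IsContractingWith ρ Z) {L A κ : ℝ} (hL : 1 ≤ L) (hA : 0 ≤ A) (hκ : Admissible ρ L A κ)
    {c : ℝ → X} {a b : ℝ} (hab : a ≤ b) (hc : ContinuousOn c (Set.Icc a b))
    (hq : IsQuasiGeodesicOn L A c (Set.Icc a b))
    (hfar : ∀ t ∈ Set.Icc a b, κ ≤ Metric.infDist (c t) Z) :
    b - a ≤ 8 * L * (Metric.infDist (c a) Z + Metric.infDist (c b) Z + A) := by
  have hL0 : 0 < L := by linarith
  obtain ⟨p, hp⟩ := hZ (c a)
  obtain ⟨q, hq'⟩ := hZ (c b)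
  obtain ⟨n, hn⟩ := exists_nat_ge (b - a)
  have ha : a ∈ Set.Icc a b := ⟨le_rfl, hab⟩
  have hb : b ∈ Set.Icc a b := ⟨hab, le_rfl⟩
  set d := Metric.infDist (c a) Z
  set e := Metric.infDist (c b) Z
  have hd : 0 ≤ d := Metric.infDist_nonneg
  have he : 0 ≤ e := Metric.infDist_nonneg
  -- M is the crude bound obtained by moving from c a for the whole time.
  have h1 := dist_proj_le_of_excursion hZ hρ hL hκ n a hab hn hc hq hfar
    (M := d + (L * (b - a) + A)) (fun t ht => by
      have := (hq.le_of_le hL ha ht ht.1).2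
      have h2 := infDist_le_infDist_add Z (c t) (c a)
      rw [dist_comm] at h2
      have : L * (t - a) ≤ L * (b - a) := by nlinarith [ht.2]
      linarith) p hp q hq'
  have h2 := (hq.le_of_le hL ha hb hab).1
  have h3 : dist (c a) (c b) ≤ d + dist p q + e := by
    have := dist_triangle4 (c a) p q (c b)
    rw [hp.2, dist_comm q, hq'.2] at this
    exact this
  have h4 : L * (d + (L * (b - a) + A)) / (3 * L ^ 2) ≤ (d + A) / 3 + (b - a) / 3 := by
    rw [div_le_iff₀ (by positivity)]
    nlinarith [mul_nonneg (add_nonneg hd hA) (mul_nonneg hL0.le (sub_nonneg.2 hL))]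
  have h5 : L * dist p q ≤ (b - a) / 2 + (d + A) / 3 + (b - a) / 3 := by
    calc L * dist p q ≤ L * ((b - a) / (2 * L) + (d + (L * (b - a) + A)) / (3 * L ^ 2)) :=
          mul_le_mul_of_nonneg_left h1 hL0.le
      _ = (b - a) / 2 + L * (d + (L * (b - a) + A)) / (3 * L ^ 2) := by field_simp
      _ ≤ _ := by linarith
  -- The projection accounts for 1/2 + 1/3 of b - a; the remaining sixth is at most (L + 1/3) (d + e
  -- + A), whence the factor 8 L.
  nlinarith

theorem exists_last_eq {f : ℝ → ℝ} {a b k : ℝ} (hab : a ≤ b) (hf : ContinuousOn f (Set.Icc a b))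
    (ha : f a ≤ k) (hb : k ≤ f b) :
    ∃ t ∈ Set.Icc a b, f t = k ∧ ∀ s ∈ Set.Icc t b, k ≤ f s := by
  have hS : IsCompact (Set.Icc a b ∩ f ⁻¹' {k}) :=
    (isCompact_Icc).of_isClosed_subset
      (hf.preimage_isClosed_of_isClosed isClosed_Icc isClosed_singleton) Set.inter_subset_left
  obtain ⟨t₁, ht₁, ht₁'⟩ := intermediate_value_Icc hab hf ⟨ha, hb⟩
  obtain ⟨t, ht⟩ := hS.exists_isGreatest ⟨t₁, ht₁, ht₁'⟩
  refine ⟨t, ht.1.1, ht.1.2, fun s hs => ?_⟩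
  by_contra! hlt
  have hsb : s ∈ Set.Icc a b := ⟨ht.1.1.1.trans hs.1, hs.2⟩
  obtain ⟨u, hu, hu'⟩ := intermediate_value_Icc hs.2
    (hf.mono (Set.Icc_subset_Icc_left hsb.1)) ⟨hlt.le, hb⟩
  have h1 : u ≤ t := ht.2 ⟨⟨hsb.1.trans hu.1, hu.2⟩, hu'⟩
  have h2 : s = t := le_antisymm (hu.1.trans h1) hs.1
  rw [h2, show f t = k from ht.1.2] at hlt
  exact lt_irrefl _ hlt

theorem exists_first_eq {f : ℝ → ℝ} {a b k : ℝ} (hab : a ≤ b) (hf : ContinuousOn f (Set.Icc a b))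
    (ha : k ≤ f a) (hb : f b ≤ k) :
    ∃ t ∈ Set.Icc a b, f t = k ∧ ∀ s ∈ Set.Icc a t, k ≤ f s := by
  obtain ⟨t, ht, h1, h2⟩ := exists_last_eq (f := fun t => f (-t)) (a := -b) (b := -a) (k := k)
    (by linarith) (hf.comp continuous_neg.continuousOn fun t ht =>
      ⟨by linarith [ht.2], by linarith [ht.1]⟩) (by simpa) (by simpa)
  refine ⟨-t, ⟨by linarith [ht.2], by linarith [ht.1]⟩, h1, fun s hs => ?_⟩
  simpa using h2 (-s) ⟨by linarith [hs.2], by linarith [hs.1]⟩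

/-- Going backwards along a quasi-geodesic from a point at distance at most `J` of a contracting
set, the `κ`-neighbourhood of the set is reached after a bounded time. -/
theorem exists_infDist_le_of_excursion {ρ : ℝ → ℝ} {Z : Set X} (hZ : ∀ x, (proj Z x).Nonempty)
    (hρ : IsContractingWith ρ Z) {L A κ : ℝ} (hL : 1 ≤ L) (hA : 0 ≤ A) (hκ : Admissible ρ L A κ)
    {c : ℝ → X} {a b J : ℝ} (hab : a ≤ b) (hc : ContinuousOn c (Set.Icc a b))
    (hq : IsQuasiGeodesicOn L A c (Set.Icc a b)) (ha : Metric.infDist (c a) Z ≤ κ)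
    (hb : Metric.infDist (c b) Z ≤ J) :
    ∃ t ∈ Set.Icc a b, Metric.infDist (c t) Z ≤ κ ∧ b - t ≤ 8 * L * (κ + J + A) := by
  have hJ : 0 ≤ J := Metric.infDist_nonneg.trans hb
  have hκ0 : 0 ≤ κ := Metric.infDist_nonneg.trans ha
  by_cases h : Metric.infDist (c b) Z ≤ κ
  · exact ⟨b, ⟨hab, le_rfl⟩, h, by rw [sub_self]; positivity⟩
  · obtain ⟨t, ht, h1, h2⟩ := exists_last_eq hab (continuousOn_infDist hc Z) ha (not_le.1 h).le
    have hsub : Set.Icc t b ⊆ Set.Icc a b := Set.Icc_subset_Icc_left ht.1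
    have h3 := length_le_of_excursion hZ hρ hL hA hκ ht.2 (hc.mono hsub) (hq.mono hsub) h2
    refine ⟨t, ht, h1.le, h3.trans ?_⟩
    rw [h1]
    gcongr

/-- The constant of the Morse property of contracting sets. -/
def morseBound (L A J : ℝ) : ℝ := J + L * (8 * L * (J + J + A)) + A

theorem le_morseBound {L A J : ℝ} (hL : 1 ≤ L) (hA : 0 ≤ A) (hJ : 0 ≤ J) :
    J ≤ morseBound L A J := by
  have : 0 ≤ L * (8 * L * (J + J + A)) := by positivity
  unfold morseBound
  linarith

/-- Contracting sets have the Morse property. -/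
theorem infDist_le_morseBound {ρ : ℝ → ℝ} {Z : Set X} (hZ : ∀ x, (proj Z x).Nonempty)
    (hρ : IsContractingWith ρ Z) {L A J : ℝ} (hL : 1 ≤ L) (hA : 0 ≤ A) (hJ : Admissible ρ L A J)
    {c : ℝ → X} {a b : ℝ} (hc : ContinuousOn c (Set.Icc a b))
    (hq : IsQuasiGeodesicOn L A c (Set.Icc a b)) (ha : Metric.infDist (c a) Z ≤ J)
    (hb : Metric.infDist (c b) Z ≤ J) {t : ℝ} (ht : t ∈ Set.Icc a b) :
    Metric.infDist (c t) Z ≤ morseBound L A J := by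
  have hJ0 : 0 ≤ J := Metric.infDist_nonneg.trans ha
  by_cases h : Metric.infDist (c t) Z ≤ J
  · exact h.trans (le_morseBound hL hA hJ0)
  · push Not at h
    have hf := continuousOn_infDist hc Z
    obtain ⟨t₀, ht₀, h1, h2⟩ := exists_last_eq ht.1
      (hf.mono (Set.Icc_subset_Icc_right ht.2)) ha h.le
    obtain ⟨t₁, ht₁, h3, h4⟩ := exists_first_eq ht.2
      (hf.mono (Set.Icc_subset_Icc_left ht.1)) h.le hb
    have hsub : Set.Icc t₀ t₁ ⊆ Set.Icc a b := Set.Icc_subset_Icc ht₀.1 ht₁.2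
    have hq' := hq.mono hsub
    have h5 := length_le_of_excursion hZ hρ hL hA hJ (ht₀.2.trans ht₁.1) (hc.mono hsub) hq'
      (fun s hs => (le_total s t).elim (fun hst => h2 s ⟨hs.1, hst⟩) fun hst => h4 s ⟨hst, hs.2⟩)
    rw [h1, h3] at h5
    have h6 := (hq'.le_of_le hL ⟨le_rfl, ht₀.2.trans ht₁.1⟩ ⟨ht₀.2, ht₁.1⟩ ht₀.2).2
    have h7 := infDist_le_infDist_add Z (c t) (c t₀)
    rw [dist_comm] at h7
    have h8 : L * (t - t₀) ≤ L * (8 * L * (J + J + A)) :=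
      mul_le_mul_of_nonneg_left (by linarith [ht₁.1]) (by linarith)
    unfold morseBound
    linarith

/-- A quasi-geodesic ray at bounded distance of a contracting set keeps returning to its
`κ`-neighbourhood. -/
theorem exists_ge_infDist_le {ρ : ℝ → ℝ} {Z : Set X} (hZ : ∀ x, (proj Z x).Nonempty)
    (hρ : IsContractingWith ρ Z) {L A κ : ℝ} (hL : 1 ≤ L) (hA : 0 ≤ A) (hκ : Admissible ρ L A κ)
    {c : ℝ → X} (hc : ContinuousOn c (Set.Ici 0)) (hq : IsQuasiGeodesicOn L A c (Set.Ici 0))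
    {D : ℝ} (hD : ∀ t ∈ Set.Ici (0 : ℝ), Metric.infDist (c t) Z ≤ D) {T : ℝ} (hT : 0 ≤ T) :
    ∃ t, T ≤ t ∧ Metric.infDist (c t) Z ≤ κ := by
  by_contra! h
  have hD0 : 0 ≤ D := Metric.infDist_nonneg.trans (hD 0 (Set.mem_Ici.2 le_rfl))
  set b := T + 8 * L * (D + D + A) + 1 with hb
  have hTb : T ≤ b := by
    have : 0 ≤ 8 * L * (D + D + A) := by positivity
    linarith
  have hsub : Set.Icc T b ⊆ Set.Ici 0 := fun t ht => hT.trans ht.1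
  have h1 := length_le_of_excursion hZ hρ hL hA hκ hTb (hc.mono hsub) (hq.mono hsub)
    fun t ht => (h t ht.1).le
  have h2 : 8 * L * (Metric.infDist (c T) Z + Metric.infDist (c b) Z + A) ≤
      8 * L * (D + D + A) := by
    have h3 := hD T hT
    have h4 := hD b (hT.trans hTb)
    gcongr
  linarith

theorem infDist_le_morseBound_of_ray {ρ : ℝ → ℝ} {Z : Set X} (hZ : ∀ x, (proj Z x).Nonempty)
    (hρ : IsContractingWith ρ Z) {L A κ : ℝ} (hL : 1 ≤ L) (hA : 0 ≤ A) (hκ : Admissible ρ L A κ)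
    {c : ℝ → X} (hc : ContinuousOn c (Set.Ici 0)) (hq : IsQuasiGeodesicOn L A c (Set.Ici 0))
    (h0 : Metric.infDist (c 0) Z ≤ κ)
    {D : ℝ} (hD : ∀ t ∈ Set.Ici (0 : ℝ), Metric.infDist (c t) Z ≤ D) {t : ℝ} (ht : 0 ≤ t) :
    Metric.infDist (c t) Z ≤ morseBound L A κ := by
  obtain ⟨b, hb, hb'⟩ := exists_ge_infDist_le hZ hρ hL hA hκ hc hq hD ht
  have hsub : Set.Icc 0 b ⊆ Set.Ici 0 := fun t ht => ht.1
  exact infDist_le_morseBound hZ hρ hL hA hκ (hc.mono hsub) (hq.mono hsub) h0 hb' ⟨ht, hb⟩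

/-! ### Contraction is stable under finite Hausdorff distance -/

theorem IsGeodesicSpace.exists_point (hX : IsGeodesicSpace X) (x y : X) {r : ℝ} (hr : 0 ≤ r)
    (hr' : r ≤ dist x y) : ∃ z, dist x z = r ∧ dist z y = dist x y - r := by
  obtain ⟨c, h0, h1, h⟩ := hX x y
  refine ⟨c r, ?_, ?_⟩
  · have := h 0 ⟨le_rfl, dist_nonneg⟩ r ⟨hr, hr'⟩
    rwa [h0, zero_sub, abs_neg, abs_of_nonneg hr] at this
  · have := h r ⟨hr, hr'⟩ _ ⟨dist_nonneg, le_rfl⟩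
    rwa [h1, abs_sub_comm, abs_of_nonneg (sub_nonneg.2 hr')] at this

theorem proj_nonempty [ProperSpace X] {Z : Set X} (hZ : IsClosed Z) (hne : Z.Nonempty) (x : X) :
    (proj Z x).Nonempty := by
  obtain ⟨z, hz, h⟩ := hZ.exists_infDist_eq_dist hne x
  exact ⟨z, hz, h.symm⟩

/-- The Hausdorff distance of `S` and `T` is at most `C`, with the infima attained. -/
def IsNear (C : ℝ) (S T : Set X) : Prop :=
  (∀ x ∈ S, ∃ y ∈ T, dist x y ≤ C) ∧ ∀ y ∈ T, ∃ x ∈ S, dist y x ≤ C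

theorem IsNear.symm {C : ℝ} {S T : Set X} (h : IsNear C S T) : IsNear C T S := ⟨h.2, h.1⟩

theorem IsNear.trans {C D : ℝ} {S T U : Set X} (h : IsNear C S T) (h' : IsNear D T U) :
    IsNear (C + D) S U := by
  refine ⟨fun x hx => ?_, fun z hz => ?_⟩
  · obtain ⟨y, hy, h1⟩ := h.1 x hx
    obtain ⟨z, hz, h2⟩ := h'.1 y hy
    exact ⟨z, hz, (dist_triangle x y z).trans (add_le_add h1 h2)⟩
  · obtain ⟨y, hy, h1⟩ := h'.2 z hz
    obtain ⟨x, hx, h2⟩ := h.2 y hy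
    exact ⟨x, hx, (dist_triangle z y x).trans (by linarith)⟩

theorem IsNear.hausdorffEDist_ne_top {C : ℝ} {S T : Set X} (h : IsNear C S T) :
    Metric.hausdorffEDist S T ≠ ⊤ := by
  refine ne_top_of_le_ne_top (ENNReal.ofReal_ne_top (r := C))
    (Metric.hausdorffEDist_le_of_mem_edist (fun x hx => ?_) fun y hy => ?_)
  · obtain ⟨y, hy, h⟩ := h.1 x hx
    exact ⟨y, hy, by rw [edist_dist]; exact ENNReal.ofReal_le_ofReal h⟩
  · obtain ⟨x, hx, h⟩ := h.2 y hy
    exact ⟨x, hx, by rw [edist_dist]; exact ENNReal.ofReal_le_ofReal h⟩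

theorem exists_isNear {S T : Set X} (h : Metric.hausdorffEDist S T ≠ ⊤) :
    ∃ C, 0 ≤ C ∧ IsNear C S T := by
  have h1 : Metric.hausdorffEDist S T <
      ENNReal.ofReal ((Metric.hausdorffEDist S T).toReal + 1) := by
    rw [ENNReal.lt_ofReal_iff_toReal_lt h]
    linarith
  refine ⟨(Metric.hausdorffEDist S T).toReal + 1, by positivity, fun x hx => ?_, fun y hy => ?_⟩
  · obtain ⟨y, hy, h2⟩ := Metric.exists_edist_lt_of_hausdorffEDist_lt hx h1
    refine ⟨y, hy, ?_⟩
    rw [edist_dist] at h2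
    exact ((ENNReal.ofReal_lt_ofReal_iff (by positivity)).1 h2).le
  · rw [Metric.hausdorffEDist_comm] at h1
    obtain ⟨x, hx, h2⟩ := Metric.exists_edist_lt_of_hausdorffEDist_lt hy h1
    refine ⟨x, hx, ?_⟩
    rw [edist_dist, Metric.hausdorffEDist_comm] at h2
    exact ((ENNReal.ofReal_lt_ofReal_iff (by positivity)).1 h2).le

theorem infDist_le_of_subset_near {C : ℝ} {S T : Set X} (hS : S.Nonempty)
    (h : ∀ x ∈ S, ∃ y ∈ T, dist x y ≤ C) (x : X) :
    Metric.infDist x T ≤ Metric.infDist x S + C := by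
  rw [← sub_le_iff_le_add, Metric.le_infDist hS]
  intro y hy
  obtain ⟨z, hz, hyz⟩ := h y hy
  linarith [Metric.infDist_le_dist_of_mem (x := x) hz, dist_triangle x y z]

theorem IsContractingWith.nonneg {ρ : ℝ → ℝ} {Z : Set X} (h : IsContractingWith ρ Z)
    (hne : Z.Nonempty) (hm : MonotoneOn ρ (Set.Ici 0)) {r : ℝ} (hr : 0 ≤ r) : 0 ≤ ρ r := by
  obtain ⟨z, hz⟩ := hne
  have h1 := h z z (by rw [dist_self]; exact Metric.infDist_nonneg)
  rw [Metric.infDist_zero_of_mem hz] at h1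
  exact (Metric.diam_nonneg.trans h1).trans (hm (Set.mem_Ici.2 le_rfl) hr hr)

/-- The contraction function of a set at Hausdorff distance at most `C` from a `ρ`-contracting
set. -/
def nearRho (ρ : ℝ → ℝ) (C r : ℝ) : ℝ := 4 * ρ (2 * r + 3 * C) + 14 * C

theorem isSublinear_nearRho {ρ : ℝ → ℝ} (h : IsSublinear ρ) {C : ℝ} (hC : 0 ≤ C) :
    IsSublinear (nearRho ρ C) := by
  have hlim : Tendsto (fun r : ℝ => 2 * r + 3 * C) atTop atTop :=
    tendsto_atTop_add_const_right _ _ (tendsto_id.const_mul_atTop two_pos)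
  refine ⟨fun r hr s hs hrs => ?_, ?_, ?_⟩
  · rw [Set.mem_Ici] at hr hs
    have := h.1 (show (0 : ℝ) ≤ 2 * r + 3 * C by positivity)
      (show (0 : ℝ) ≤ 2 * s + 3 * C by positivity) (by linarith)
    unfold nearRho
    linarith
  · filter_upwards [hlim.eventually h.2.1] with r hr
    unfold nearRho
    positivity
  · have h1 : Tendsto (fun r : ℝ => C / r) atTop (𝓝 0) := tendsto_const_nhds.div_atTop tendsto_id
    have h2 := h.2.2.comp hlim
    have h3 : Tendsto (fun r : ℝ => 4 * (ρ (2 * r + 3 * C) / (2 * r + 3 * C) * (2 + 3 * (C / r)))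
        + 14 * (C / r)) atTop (𝓝 (4 * (0 * (2 + 3 * 0)) + 14 * 0)) :=
      ((h2.mul ((h1.const_mul 3).const_add 2)).const_mul 4).add (h1.const_mul 14)
    simp only [zero_mul, mul_zero, add_zero] at h3
    refine h3.congr' ?_
    filter_upwards [eventually_gt_atTop 0] with r hr
    have : 0 < 2 * r + 3 * C := by positivity
    unfold nearRho
    field_simp

/-- Take z in Z within C of p' and walk from x towards z for the distance d(x, Z). Contraction
controls the projection q of the point y reached, and y is within 2 C of z, so q, y, z, p' are
successively within 2 C, 2 C, C. -/
theorem IsContractingWith.dist_proj_near {ρ : ℝ → ℝ} {Z Z' : Set X} (hX : IsGeodesicSpace X)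
    (hZ : ∀ x, (proj Z x).Nonempty) (h : IsContractingWith ρ Z) {C : ℝ} (hC : IsNear C Z Z')
    {x p p' : X} (hp : p ∈ proj Z x) (hp' : p' ∈ proj Z' x) :
    dist p p' ≤ ρ (Metric.infDist x Z) + 5 * C := by
  obtain ⟨z, hz, hzp⟩ := hC.2 p' hp'.1
  have h1 := infDist_le_of_subset_near ⟨p, hp.1⟩ hC.1 x
  have h2 := Metric.infDist_le_dist_of_mem (x := x) hz
  have h3 := dist_triangle x p' z
  rw [hp'.2] at h3
  obtain ⟨y, hy, hy'⟩ := hX.exists_point x z Metric.infDist_nonneg h2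
  obtain ⟨q, hq⟩ := hZ y
  have h4 := h.dist_le hy.le hp hq
  have h5 : dist y q ≤ dist y z := by rw [hq.2]; exact Metric.infDist_le_dist_of_mem hz
  have h6 := dist_triangle4 p q y z
  rw [dist_comm q y] at h6
  have h7 := dist_triangle p z p'
  rw [dist_comm z p'] at h7
  linarith

/-- The ball of radius d(x, Z) + C is reached by one jump of length d(x, Z) and a remainder of
length at most C. Either the remainder is again an admissible jump, or it exceeds the distance to Z
and everything lies within a multiple of C. -/
theorem IsContractingWith.dist_proj_far {ρ : ℝ → ℝ} {Z : Set X} (hX : IsGeodesicSpace X)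
    (hZ : ∀ x, (proj Z x).Nonempty) (h : IsContractingWith ρ Z) (hm : MonotoneOn ρ (Set.Ici 0))
    {C : ℝ} (hC : 0 ≤ C) {x y p q : X} (hxy : dist x y ≤ Metric.infDist x Z + C)
    (hp : p ∈ proj Z x) (hq : q ∈ proj Z y) :
    dist p q ≤ 2 * ρ (2 * Metric.infDist x Z) + 4 * C := by
  have hR : 0 ≤ Metric.infDist x Z := Metric.infDist_nonneg
  have hmono : ρ (Metric.infDist x Z) ≤ ρ (2 * Metric.infDist x Z) :=
    hm hR (show (0 : ℝ) ≤ _ by positivity) (by linarith)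
  have h2R := h.nonneg ⟨p, hp.1⟩ hm (show 0 ≤ 2 * Metric.infDist x Z by positivity)
  rcases le_total (dist x y) (Metric.infDist x Z) with h1 | h1
  · have := h.dist_le h1 hp hq
    linarith
  · obtain ⟨y', hy, hy'⟩ := hX.exists_point x y hR h1
    obtain ⟨q', hq'⟩ := hZ y'
    have h2 := h.dist_le hy.le hp hq'
    have h3 := dist_triangle p q' q
    have h4 := infDist_le_infDist_add Z y' x
    rw [dist_comm, hy] at h4
    rcases le_total (dist y' y) (Metric.infDist y' Z) with h5 | h5
    · have h6 := h.dist_le h5 hq' hq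
      have h7 : ρ (Metric.infDist y' Z) ≤ ρ (2 * Metric.infDist x Z) :=
        hm Metric.infDist_nonneg (show (0 : ℝ) ≤ _ by positivity) (by linarith)
      linarith
    · have h6 := dist_triangle4 q' y' y q
      rw [dist_comm q' y', hq'.2, hq.2] at h6
      have h7 := infDist_le_infDist_add Z y y'
      rw [dist_comm] at h7
      linarith

/-- A set near a contracting set is contracting. -/
theorem IsContractingWith.near {ρ : ℝ → ℝ} {Z Z' : Set X} (hX : IsGeodesicSpace X)
    (hZ : ∀ x, (proj Z x).Nonempty) (h : IsContractingWith ρ Z) (hm : MonotoneOn ρ (Set.Ici 0))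
    {C : ℝ} (hC : 0 ≤ C) (hn : IsNear C Z Z') : IsContractingWith (nearRho ρ C) Z' := by
  intro x y hxy
  obtain ⟨p, hp⟩ := hZ x
  obtain ⟨q, hq⟩ := hZ y
  have hne : Z.Nonempty := ⟨p, hp.1⟩
  have hne' : Z'.Nonempty := (hn.1 p hp.1).imp fun _ h => h.1
  have h1 := infDist_le_of_subset_near hne hn.1 x
  have h2 := infDist_le_of_subset_near hne' hn.2 x
  have hR : 0 ≤ Metric.infDist x Z' := Metric.infDist_nonneg
  have hR' : 0 ≤ Metric.infDist x Z := Metric.infDist_nonneg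
  set P := ρ (2 * Metric.infDist x Z' + 3 * C) with hP
  have hle : ∀ r, 0 ≤ r → r ≤ 2 * Metric.infDist x Z' + 3 * C → ρ r ≤ P := fun r hr hr' =>
    hm hr (show (0 : ℝ) ≤ _ by positivity) hr'
  have hP0 : 0 ≤ P := h.nonneg hne hm (by positivity)
  have hxp : ∀ p' ∈ proj Z' x, dist p p' ≤ P + 5 * C := fun p' hp' =>
    (h.dist_proj_near hX hZ hn hp hp').trans (by linarith [hle _ hR' (by linarith)])
  have hy := infDist_le_infDist_add Z y x
  rw [dist_comm] at hy
  have hyq : ∀ q' ∈ proj Z' y, dist q q' ≤ P + 5 * C := fun q' hq' =>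
    (h.dist_proj_near hX hZ hn hq hq').trans
      (by linarith [hle _ (Metric.infDist_nonneg (x := y) (s := Z)) (by linarith)])
  have hpq : dist p q ≤ 2 * P + 4 * C :=
    (h.dist_proj_far hX hZ hm hC (by linarith) hp hq).trans
      (by linarith [hle (2 * Metric.infDist x Z) (by positivity) (by linarith)])
  -- The worst pairs are the mixed ones: (P + 5 C) + (2 P + 4 C) + (P + 5 C).
  refine Metric.diam_le_of_forall_dist_le (by unfold nearRho; positivity) ?_
  unfold nearRho
  rw [← hP]
  rintro a (ha | ha) b (hb | hb)
  · linarith [dist_triangle_left a b p, hxp a ha, hxp b hb]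
  · have := dist_triangle4 a p q b
    rw [dist_comm a p] at this
    linarith [hxp a ha, hyq b hb]
  · have := dist_triangle4 a q p b
    rw [dist_comm a q, dist_comm q p] at this
    linarith [hyq a ha, hxp b hb]
  · linarith [dist_triangle_left a b q, hyq a ha, hyq b hb]

theorem isClosed_image_of_isQuasiGeodesicOn {L A : ℝ} (hL : 1 ≤ L) {c : ℝ → X}
    (hc : ContinuousOn c (Set.Ici 0)) (hq : IsQuasiGeodesicOn L A c (Set.Ici 0)) :
    IsClosed (c '' Set.Ici 0) := by
  refine isClosed_of_closure_subset fun x hx => ?_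
  set T := max 0 (L * (dist (c 0) x + 1 + A)) with hT
  have hT0 : 0 ≤ T := le_max_left _ _
  have hun : c '' Set.Ici 0 ⊆ c '' Set.Icc 0 T ∪ c '' Set.Ioi T := by
    rintro _ ⟨t, ht, rfl⟩
    rcases le_or_gt t T with h | h
    · exact Or.inl ⟨t, ⟨ht, h⟩, rfl⟩
    · exact Or.inr ⟨t, h, rfl⟩
  have hcl : IsClosed (c '' Set.Icc 0 T) :=
    (isCompact_Icc.image_of_continuousOn (hc.mono fun t ht => ht.1)).isClosed
  have := closure_mono hun hx
  rw [closure_union, hcl.closure_eq] at this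
  rcases this with ⟨t, ht, rfl⟩ | h
  · exact ⟨t, ht.1, rfl⟩
  · obtain ⟨_, ⟨t, ht, rfl⟩, hd⟩ := Metric.mem_closure_iff.1 h 1 one_pos
    have ht' : T < t := ht
    have h1 := (hq.le_of_le hL (Set.mem_Ici.2 le_rfl) (hT0.trans ht'.le) (hT0.trans ht'.le)).1
    have h2 := dist_triangle (c 0) x (c t)
    have h3 : L * (dist (c 0) (c t) + A) ≤ L * (dist (c 0) x + 1 + A) :=
      mul_le_mul_of_nonneg_left (by linarith) (by linarith)
    linarith [le_max_right 0 (L * (dist (c 0) x + 1 + A))]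

theorem IsContracting.near (hX : IsGeodesicSpace X) {Z Z' : Set X}
    (h : IsContracting Z) {C : ℝ} (hC : 0 ≤ C) (hn : IsNear C Z Z')
    (hZ' : ∀ x, (proj Z' x).Nonempty) : IsContracting Z' := by
  obtain ⟨hZ, ρ, hρ, hc⟩ := h
  exact ⟨hZ', nearRho ρ C, isSublinear_nearRho hρ hC, hc.near hX hZ hρ.1 hC hn⟩

/-- A continuous quasi-geodesic ray asymptotic to a boundary point belongs to its class. -/
theorem exists_ray [ProperSpace X] (hX : IsGeodesicSpace X) {o : X} {L A : ℝ} (hL : 1 ≤ L)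
    (hA : 0 ≤ A) {c : ℝ → X} (h0 : c 0 = o) (hc : ContinuousOn c (Set.Ici 0))
    (hq : IsQuasiGeodesicOn L A c (Set.Ici 0)) {ζ : Boundary X o}
    (hζ : AsymptoticTo (c '' Set.Ici 0) ζ) :
    ∃ β : Ray X o, β.toFun = c ∧ β.toBoundary = ζ := by
  obtain ⟨α, hα, hd⟩ := hζ
  obtain ⟨C, hC, hn⟩ := exists_isNear hd
  refine ⟨⟨c, h0, ⟨L, A, hL, hA, hq⟩, α.contracting.near hX hC hn.symm
    (proj_nonempty (isClosed_image_of_isQuasiGeodesicOn hL hc hq) ⟨c 0, 0, Set.self_mem_Ici, rfl⟩)⟩, rfl, ?_⟩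
  rw [← hα]
  exact Quotient.sound hd

theorem toBoundary_eq_iff {o : X} {α β : Ray X o} :
    α.toBoundary = β.toBoundary ↔ Metric.hausdorffEDist α.image β.image ≠ ⊤ :=
  Quotient.eq

/-! ### The constant κ -/

theorem exists_mul_le_of_isSublinear {ρ : ℝ → ℝ} (h : IsSublinear ρ) {L : ℝ} (hL : 1 ≤ L) :
    {R : ℝ | 0 < R ∧ ∀ r, R ≤ r → 3 * L ^ 2 * ρ r ≤ r}.Nonempty := by
  have hL0 : 0 < L := by linarith
  have h1 := h.2.2.eventually (gt_mem_nhds (show (0 : ℝ) < 1 / (3 * L ^ 2) by positivity))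
  obtain ⟨R, hR⟩ := eventually_atTop.1 h1
  refine ⟨max R 1, by positivity, fun r hr => ?_⟩
  have hr0 : 0 < r := lt_of_lt_of_le one_pos ((le_max_right R 1).trans hr)
  have := (hR r ((le_max_left R 1).trans hr)).le
  rw [div_le_iff₀ hr0, div_mul_eq_mul_div, one_mul, le_div_iff₀ (by positivity)] at this
  linarith

theorem bddBelow_kappaSet (ρ : ℝ → ℝ) (L : ℝ) :
    BddBelow {R : ℝ | 0 < R ∧ ∀ r, R ≤ r → 3 * L ^ 2 * ρ r ≤ r} := ⟨0, fun _ h => h.1.le⟩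

theorem admissible_kappa {ρ : ℝ → ℝ} (h : IsSublinear ρ) {L : ℝ} (hL : 1 ≤ L) (A : ℝ) :
    Admissible ρ L A (kappa ρ L A) := by
  refine ⟨le_max_left _ _, (le_max_left _ _).trans (le_max_right _ _), fun r hr => ?_⟩
  -- The summand 1 in κ is used here: the infimum need not be attained, but some admissible R lies
  -- below it plus 1.
  obtain ⟨R, hR, hlt⟩ := exists_lt_of_csInf_lt (exists_mul_le_of_isSublinear h hL) (lt_add_one _)
  refine hR.2 r (le_trans ?_ hr)
  have := (le_max_right (3 * L ^ 2) _).trans (le_max_right (3 * A)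
    (max (3 * L ^ 2) (1 + sInf {R : ℝ | 0 < R ∧ ∀ r, R ≤ r → 3 * L ^ 2 * ρ r ≤ r})))
  unfold kappa
  linarith

theorem kappa_mono {ρ : ℝ → ℝ} (h : IsSublinear ρ) (h0 : ∀ r, 0 ≤ r → 0 ≤ ρ r)
    {L L' A A' : ℝ} (hL : 1 ≤ L) (hL' : L ≤ L') (hA : A ≤ A') :
    kappa ρ L A ≤ kappa ρ L' A' := by
  have hsq : L ^ 2 ≤ L' ^ 2 := by gcongr
  refine max_le_max (by linarith) (max_le_max (by linarith) (add_le_add le_rfl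
    (csInf_le_csInf (bddBelow_kappaSet ρ L) (exists_mul_le_of_isSublinear h (hL.trans hL'))
      fun R hR => ⟨hR.1, fun r hr => le_trans ?_ (hR.2 r hr)⟩)))
  exact mul_le_mul_of_nonneg_right (by linarith) (h0 r (hR.1.le.trans hr))

theorem kappa_nonneg (ρ : ℝ → ℝ) (L A : ℝ) : 0 ≤ kappa ρ L A :=
  (by positivity : 0 ≤ 3 * L ^ 2).trans ((le_max_left _ _).trans (le_max_right _ _))

/-! ### Geodesic representatives and the function ρ_ζ -/

theorem continuousOn_of_isometric {c : ℝ → X} {I : Set ℝ}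
    (h : ∀ s ∈ I, ∀ t ∈ I, dist (c s) (c t) = |s - t|) : ContinuousOn c I := by
  have : LipschitzOnWith 1 c I := LipschitzOnWith.of_dist_le_mul fun s hs t ht => by
    rw [h s hs t ht, NNReal.coe_one, one_mul, Real.dist_eq]
  exact this.continuousOn

theorem isQuasiGeodesicOn_of_isometric {c : ℝ → X} {I : Set ℝ}
    (h : ∀ s ∈ I, ∀ t ∈ I, dist (c s) (c t) = |s - t|) : IsQuasiGeodesicOn 1 0 c I :=
  fun s hs t ht => by rw [h s hs t ht]; simp

/-- Pointwise limits along an ultrafilter replace the Arzelà–Ascoli argument: they exist by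
properness, and distances and bounds pass to the limit. Truncating the time to `min |t| (d n)` keeps
it in the domain and is eventually harmless. -/
theorem exists_geodesic_limit [ProperSpace X] {o : X} {c : ℕ → ℝ → X} {d : ℕ → ℝ}
    (hd0 : ∀ n, 0 ≤ d n) (hd : Tendsto d atTop atTop) (h0 : ∀ n, c n 0 = o)
    (hc : ∀ n, ∀ s ∈ Set.Icc 0 (d n), ∀ t ∈ Set.Icc 0 (d n), dist (c n s) (c n t) = |s - t|)
    {Z : Set X} {M : ℝ} (hM : ∀ n, ∀ t ∈ Set.Icc 0 (d n), Metric.infDist (c n t) Z ≤ M) :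
    ∃ α : ℝ → X, α 0 = o ∧
      (∀ s ∈ Set.Ici (0 : ℝ), ∀ t ∈ Set.Ici (0 : ℝ), dist (α s) (α t) = |s - t|) ∧
      ∀ t, Metric.infDist (α t) Z ≤ M := by
  have hmem : ∀ t n, min |t| (d n) ∈ Set.Icc 0 (d n) := fun t n =>
    ⟨le_min (abs_nonneg _) (hd0 n), min_le_right _ _⟩
  have hlim : ∀ t : ℝ, ∃ x, Tendsto (fun n => c n (min |t| (d n))) (hyperfilter ℕ) (𝓝 x) := by
    intro t
    have hle : (Ultrafilter.map (fun n => c n (min |t| (d n))) (hyperfilter ℕ) : Filter X) ≤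
        𝓟 (Metric.closedBall o |t|) := by
      rw [le_principal_iff, Ultrafilter.coe_map, mem_map]
      refine univ_mem' fun n => ?_
      have h1 := hc n _ (hmem t n) 0 ⟨le_rfl, hd0 n⟩
      rw [h0, sub_zero, abs_of_nonneg (hmem t n).1] at h1
      rw [Set.mem_preimage, Metric.mem_closedBall, h1]
      exact min_le_left _ _
    obtain ⟨x, -, hx⟩ := (isCompact_closedBall o |t|).ultrafilter_le_nhds _ hle
    exact ⟨x, hx⟩
  choose α hα using hlim
  have hev : ∀ t : ℝ, ∀ᶠ n in (hyperfilter ℕ : Filter ℕ), |t| ≤ d n := fun t =>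
    Nat.hyperfilter_le_atTop (hd.eventually_ge_atTop |t|)
  refine ⟨α, ?_, fun s hs t ht => ?_, fun t => ?_⟩
  · refine tendsto_nhds_unique (hα 0) (tendsto_const_nhds.congr fun n => ?_)
    rw [abs_zero, min_eq_left (hd0 n), h0]
  · refine tendsto_nhds_unique ((hα s).dist (hα t)) (tendsto_const_nhds.congr' ?_)
    filter_upwards [hev s, hev t] with n hs' ht'
    rw [hc n _ (hmem s n) _ (hmem t n), min_eq_left hs', min_eq_left ht', abs_of_nonneg (Set.mem_Ici.1 hs),
      abs_of_nonneg (Set.mem_Ici.1 ht)]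
  · exact le_of_tendsto (((Metric.continuous_infDist_pt Z).tendsto _).comp (hα t))
      (Eventually.of_forall fun n => hM n _ (hmem t n))

/-- The converse closeness needs that b has no long stretch missed by α. Parameters τ n of points of
b near α n start near 0, are unbounded and increase by bounded steps, so every t lies shortly before
some τ n. -/
theorem isNear_of_geodesic_near {o : X} {α : ℝ → X} (h0 : α 0 = o)
    (hα : ∀ s ∈ Set.Ici (0 : ℝ), ∀ t ∈ Set.Ici (0 : ℝ), dist (α s) (α t) = |s - t|)
    {K ε : ℝ} (hK : 1 ≤ K) (hε : 0 ≤ ε) {b : ℝ → X} (hb0 : b 0 = o)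
    (hb : IsQuasiGeodesicOn K ε b (Set.Ici 0)) {M : ℝ}
    (hM : ∀ t ∈ Set.Ici (0 : ℝ), ∃ u ∈ Set.Ici (0 : ℝ), dist (α t) (b u) ≤ M) :
    ∃ C, 0 ≤ C ∧ IsNear C (b '' Set.Ici 0) (α '' Set.Ici 0) := by
  have hM0 : 0 ≤ M := by
    obtain ⟨u, -, hu⟩ := hM 0 Set.self_mem_Ici
    exact dist_nonneg.trans hu
  have hn : ∀ n : ℕ, ∃ u ∈ Set.Ici (0 : ℝ), dist (α n) (b u) ≤ M := fun n => hM n (Set.mem_Ici.2 n.cast_nonneg)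
  choose τ hτ hτM using hn
  have hK0 : 0 < K := by linarith
  have hmem : ∀ n : ℕ, (n : ℝ) ∈ Set.Ici (0 : ℝ) := fun n => Set.mem_Ici.2 n.cast_nonneg
  refine ⟨M + (K * (K * (2 * M + 1 + ε)) + ε), by positivity, ?_, ?_⟩
  · rintro _ ⟨t, ht, rfl⟩
    have ht0 : 0 ≤ t := ht
    have hex : ∃ n : ℕ, t ≤ τ n := by
      obtain ⟨n, hn⟩ := exists_nat_ge (K * t + ε + M)
      refine ⟨n, ?_⟩
      have h1 := (hb.le_of_le hK Set.self_mem_Ici (hτ n) (hτ n)).2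
      have h2 := hα 0 Set.self_mem_Ici n (hmem n)
      rw [zero_sub, abs_neg, Nat.abs_cast] at h2
      have h3 := dist_triangle_right (α 0) (α n) (b (τ n))
      rw [h0, ← hb0] at h3
      rw [h0, ← hb0] at h2
      have h4 : K * t ≤ K * τ n := by linarith [hτM n]
      exact le_of_mul_le_mul_left h4 hK0
    classical
    obtain ⟨n, hn, hmin⟩ : ∃ n, t ≤ τ n ∧ ∀ m < n, τ m < t :=
      ⟨Nat.find hex, Nat.find_spec hex, fun m hm => not_le.1 (Nat.find_min hex hm)⟩
    have key : τ n - t ≤ K * (2 * M + 1 + ε) := by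
      cases n with
      | zero =>
        have h1 := (hb.le_of_le hK Set.self_mem_Ici (hτ 0) (hτ 0)).1
        have h2 := hτM 0
        rw [Nat.cast_zero, h0, ← hb0] at h2
        have : K * (dist (b 0) (b (τ 0)) + ε) ≤ K * (2 * M + 1 + ε) :=
          mul_le_mul_of_nonneg_left (by linarith) hK0.le
        linarith
      | succ m =>
        have hlt := hmin m m.lt_succ_self
        have h1 := (hb.le_of_le hK (hτ m) (hτ (m + 1)) (hlt.le.trans hn)).1
        have h2 := dist_triangle4 (b (τ m)) (α m) (α (m + 1 : ℕ)) (b (τ (m + 1)))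
        rw [hα _ (hmem m) _ (hmem (m + 1)), dist_comm _ (α m)] at h2
        have h3 : |(m : ℝ) - (m + 1 : ℕ)| = 1 := by push_cast; norm_num
        rw [h3] at h2
        have : K * (dist (b (τ m)) (b (τ (m + 1))) + ε) ≤ K * (2 * M + 1 + ε) :=
          mul_le_mul_of_nonneg_left (by linarith [hτM m, hτM (m + 1)]) hK0.le
        linarith
    refine ⟨α n, ⟨n, hmem n, rfl⟩, ?_⟩
    have h1 := (hb.le_of_le hK ht (hτ n) hn).2
    have h2 := dist_triangle_right (b t) (α n) (b (τ n))
    have h3 : K * (τ n - t) ≤ K * (K * (2 * M + 1 + ε)) := mul_le_mul_of_nonneg_left key hK0.le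
    linarith [hτM n]
  · rintro _ ⟨t, ht, rfl⟩
    obtain ⟨u, hu, h⟩ := hM t ht
    refine ⟨b u, ⟨u, hu, rfl⟩, h.trans ?_⟩
    have : 0 ≤ K * (K * (2 * M + 1 + ε)) + ε := by positivity
    linarith

/-- Every point of the contracting boundary is represented by a geodesic ray. -/
theorem exists_isGeodesic_ray [ProperSpace X] (hX : IsGeodesicSpace X) {o : X} (ζ : Boundary X o) :
    ∃ α : Ray X o, α.IsGeodesic ∧ α.toBoundary = ζ := by
  obtain ⟨β, rfl⟩ : ∃ β : Ray X o, β.toBoundary = ζ := Quotient.exists_rep ζ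
  obtain ⟨K, ε, hK, hε, hq⟩ := β.quasiGeodesic
  obtain ⟨hZ, ρ, hρ, hρ'⟩ := β.contracting
  have hne : (β.toFun '' Set.Ici 0).Nonempty := ⟨_, 0, Set.self_mem_Ici, rfl⟩
  have hκ := admissible_kappa hρ le_rfl 0
  choose c h0 h1 hc using fun n : ℕ => hX o (β.toFun n)
  have hd : Tendsto (fun n : ℕ => dist o (β.toFun n)) atTop atTop := by
    have hlin : Tendsto (fun n : ℕ => 1 / K * (n : ℝ) - ε) atTop atTop :=
      tendsto_atTop_add_const_right _ _
        (tendsto_natCast_atTop_atTop.const_mul_atTop (by positivity))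
    refine tendsto_atTop_mono (fun n => ?_) hlin
    have := (hq 0 Set.self_mem_Ici n (Set.mem_Ici.2 n.cast_nonneg)).1
    rwa [zero_sub, abs_neg, Nat.abs_cast, β.base] at this
  have hinf : ∀ t ∈ Set.Ici (0 : ℝ), Metric.infDist (β.toFun t) (β.toFun '' Set.Ici 0) ≤
      kappa ρ 1 0 := fun t ht => by
    rw [Metric.infDist_zero_of_mem (Set.mem_image_of_mem _ ht)]
    exact kappa_nonneg _ _ _
  -- The segments have both ends on the image of β, so the Morse property keeps them uniformly close
  -- to it.
  obtain ⟨α, hα0, hα, hαM⟩ := exists_geodesic_limit (fun n => dist_nonneg) hd h0 hc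
    (fun n t ht => infDist_le_morseBound hZ hρ' le_rfl le_rfl hκ
      (continuousOn_of_isometric (hc n)) (isQuasiGeodesicOn_of_isometric (hc n))
      (by have := hinf 0 Set.self_mem_Ici; rw [β.base] at this; rwa [h0 n])
      (by rw [h1 n]; exact hinf n (Set.mem_Ici.2 n.cast_nonneg)) ht)
  obtain ⟨C, hC, hn⟩ := isNear_of_geodesic_near hα0 hα hK hε β.base hq
    (M := morseBound 1 0 (kappa ρ 1 0) + 1) fun t _ => by
      obtain ⟨_, ⟨u, hu, rfl⟩, h⟩ := (Metric.infDist_lt_iff hne).1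
        ((hαM t).trans_lt (lt_add_one _))
      exact ⟨u, hu, h.le⟩
  obtain ⟨α', rfl, hα'⟩ := exists_ray hX le_rfl le_rfl hα0 (continuousOn_of_isometric hα)
    (isQuasiGeodesicOn_of_isometric hα) ⟨β, rfl, hn.symm.hausdorffEDist_ne_top⟩
  exact ⟨α', hα, hα'⟩

theorem geodesicRay_spec [ProperSpace X] (hX : IsGeodesicSpace X) {o : X} (ζ : Boundary X o) :
    (geodesicRay ζ).IsGeodesic ∧ (geodesicRay ζ).toBoundary = ζ := by
  have h := exists_isGeodesic_ray hX ζ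
  rw [geodesicRay, dif_pos h]
  exact h.choose_spec

theorem infDist_image_le_dist {f : ℝ → X} {S : Set ℝ} {t : ℝ} (ht : t ∈ S) (x : X) :
    Metric.infDist x (f '' S) ≤ dist x (f t) :=
  Metric.infDist_le_dist_of_mem (Set.mem_image_of_mem f ht)

theorem infDist_image_eq_zero {f : ℝ → X} {S : Set ℝ} {t : ℝ} (ht : t ∈ S) {x : X}
    (h : f t = x) : Metric.infDist x (f '' S) = 0 :=
  Metric.infDist_zero_of_mem ⟨t, ht, h⟩

theorem Ray.IsGeodesic.dist_base {o : X} {α : Ray X o} (h : α.IsGeodesic) {t : ℝ} (ht : 0 ≤ t) :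
    dist o (α.toFun t) = t := by
  have := h 0 Set.self_mem_Ici t ht
  rwa [zero_sub, abs_neg, abs_of_nonneg ht, α.base] at this

/-- Comparing distances to o gives |s - t| ≤ M. -/
theorem dist_le_two_mul_of_dist_le {o : X} {α β : Ray X o} (hα : α.IsGeodesic) (hβ : β.IsGeodesic)
    {s t M : ℝ} (hs : 0 ≤ s) (ht : 0 ≤ t) (h : dist (α.toFun s) (β.toFun t) ≤ M) :
    dist (α.toFun s) (β.toFun s) ≤ 2 * M := by
  have h1 := hβ s hs t ht
  have h2 := dist_triangle_right (α.toFun s) (β.toFun s) (β.toFun t)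
  have h3 := dist_triangle o (α.toFun s) (β.toFun t)
  have h4 := dist_triangle_right o (α.toFun s) (β.toFun t)
  rw [hα.dist_base hs, hβ.dist_base ht] at h3 h4
  have h5 : |s - t| ≤ M := abs_sub_le_iff.2 ⟨by linarith, by linarith⟩
  linarith

/-- Geodesic rays of the same boundary point are uniformly close. -/
theorem isNear_of_isGeodesic {o : X} {α β : Ray X o} (hα : α.IsGeodesic) (hβ : β.IsGeodesic)
    (h : α.toBoundary = β.toBoundary) {ρ : ℝ → ℝ} {κ : ℝ} (hZ : ∀ x, (proj α.image x).Nonempty)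
    (hρ : IsContractingWith ρ α.image) (hκ : Admissible ρ 1 0 κ) :
    IsNear (2 * morseBound 1 0 κ) α.image β.image := by
  have hκ0 : 0 ≤ κ := by linarith [hκ.multiplicative]
  obtain ⟨C, -, hn⟩ := exists_isNear (toBoundary_eq_iff.1 h)
  have hD : ∀ t ∈ Set.Ici (0 : ℝ), Metric.infDist (β.toFun t) α.image ≤ C := fun t ht => by
    obtain ⟨x, hx, hxt⟩ := hn.2 _ ⟨t, ht, rfl⟩
    exact (Metric.infDist_le_dist_of_mem hx).trans hxt
  have h0 : Metric.infDist (β.toFun 0) α.image ≤ κ := by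
    rw [Ray.image, infDist_image_eq_zero Set.self_mem_Ici (α.base.trans β.base.symm)]
    exact hκ0
  have key : ∀ t, 0 ≤ t → dist (β.toFun t) (α.toFun t) ≤ 2 * morseBound 1 0 κ := by
    intro t ht
    have h1 := infDist_le_morseBound_of_ray hZ hρ le_rfl le_rfl hκ (continuousOn_of_isometric hβ)
      (isQuasiGeodesicOn_of_isometric hβ) h0 hD ht
    obtain ⟨_, ⟨u, hu, rfl⟩, hp⟩ := hZ (β.toFun t)
    exact dist_le_two_mul_of_dist_le hβ hα ht hu (hp.trans_le h1)
  refine ⟨?_, ?_⟩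
  · rintro _ ⟨t, ht, rfl⟩
    exact ⟨_, ⟨t, ht, rfl⟩, by rw [dist_comm]; exact key t ht⟩
  · rintro _ ⟨t, ht, rfl⟩
    exact ⟨_, ⟨t, ht, rfl⟩, key t ht⟩

/-- The function `ρ_ζ` is sublinear, and the geodesic rays of the class `ζ` are
`ρ_ζ`-contracting. -/
theorem rhoOf_spec [ProperSpace X] (hX : IsGeodesicSpace X) {o : X} (ζ : Boundary X o) :
    IsSublinear (rhoOf ζ) ∧ (∀ r, 0 ≤ r → 0 ≤ rhoOf ζ r) ∧
      ∀ α : Ray X o, α.IsGeodesic → α.toBoundary = ζ → IsContractingWith (rhoOf ζ) α.image := by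
  obtain ⟨β, hβ, hβζ⟩ := exists_isGeodesic_ray hX ζ
  obtain ⟨hZ, ρ, hρ, hρ'⟩ := β.contracting
  have hκ := admissible_kappa hρ le_rfl 0
  set C := 2 * morseBound 1 0 (kappa ρ 1 0) with hC
  have hC0 : 0 ≤ C := by
    have h1 := kappa_nonneg ρ 1 0
    have := le_morseBound le_rfl le_rfl h1
    linarith
  -- One constant C serves all geodesic rays of the class, so a single sublinear function bounds the
  -- set whose supremum is ρ_ζ. Boundedness is essential, as the real `sSup` of an unbounded set is
  -- 0.
  have hcon : ∀ α : Ray X o, α.IsGeodesic → α.toBoundary = ζ →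
      IsContractingWith (nearRho ρ C) α.image := fun α hα hαζ =>
    hρ'.near hX hZ hρ.1 hC0
      (isNear_of_isGeodesic hβ hα (hβζ.trans hαζ.symm) hZ hρ' hκ)
  have hsub := isSublinear_nearRho hρ hC0
  have hne : β.image.Nonempty := ⟨_, 0, Set.self_mem_Ici, rfl⟩
  have hbound : ∀ r, 0 ≤ r → nearRho ρ C r ∈ upperBounds
      {D : ℝ | ∃ α : Ray X o, α.IsGeodesic ∧ α.toBoundary = ζ ∧ ∃ x y : X,
        dist x y ≤ Metric.infDist x α.image ∧ Metric.infDist x α.image ≤ r ∧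
        D = Metric.diam (proj α.image x ∪ proj α.image y)} := by
    rintro r hr _ ⟨α, hα, hαζ, x, y, hxy, hxr, rfl⟩
    exact (hcon α hα hαζ x y hxy).trans (hsub.1 Metric.infDist_nonneg hr hxr)
  have hnonneg : ∀ r, 0 ≤ rhoOf ζ r := fun r => by
    refine Real.sSup_nonneg ?_
    rintro _ ⟨α, hα, hαζ, x, y, hxy, hxr, rfl⟩
    exact Metric.diam_nonneg
  have hle : ∀ r, 0 ≤ r → rhoOf ζ r ≤ nearRho ρ C r := fun r hr =>
    Real.sSup_le (hbound r hr) (by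
      have := hρ'.nonneg hne hρ.1 (show 0 ≤ 2 * r + 3 * C by positivity)
      unfold nearRho
      positivity)
  refine ⟨⟨fun r hr s hs hrs => ?_, Eventually.of_forall hnonneg, ?_⟩, fun r _ => hnonneg r,
    fun α hα hαζ x y hxy => ?_⟩
  · refine Real.sSup_le ?_ (hnonneg s)
    rintro _ ⟨α, hα, hαζ, x, y, hxy, hxr, rfl⟩
    exact le_csSup ⟨_, hbound s hs⟩ ⟨α, hα, hαζ, x, y, hxy, hxr.trans hrs, rfl⟩
  · refine squeeze_zero' ?_ ?_ hsub.2.2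
    · filter_upwards [eventually_ge_atTop 0] with r hr
      exact div_nonneg (hnonneg r) hr
    · filter_upwards [eventually_ge_atTop 0] with r hr
      exact div_le_div_of_nonneg_right (hle r hr) hr
  · exact le_csSup ⟨_, hbound _ Metric.infDist_nonneg⟩ ⟨α, hα, hαζ, x, y, hxy, le_rfl, rfl⟩

/-! ### Fellow travelling along contracting geodesic rays -/

/-- The constant in the fellow travelling property of quasi-geodesics along contracting rays. -/
def fellowBound (L A J : ℝ) : ℝ := 3 * (morseBound L A J + 1)

/-- A quasi-geodesic from the base point to a point near a contracting geodesic ray passes near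
all earlier points of the ray. -/
theorem exists_dist_le_fellowBound {o : X} {α : Ray X o} (hα : α.IsGeodesic) {ρ : ℝ → ℝ}
    (hρ : IsContractingWith ρ α.image) {L A J : ℝ} (hL : 1 ≤ L) (hA : 0 ≤ A)
    (hJ : Admissible ρ L A J) {c : ℝ → X} {T : ℝ} (hT : 0 ≤ T) (h0 : c 0 = o)
    (hc : ContinuousOn c (Set.Icc 0 T)) (hq : IsQuasiGeodesicOn L A c (Set.Icc 0 T)) {s u : ℝ}
    (hu : 0 ≤ u) (hus : u ≤ s) (hs : dist (c T) (α.toFun s) ≤ J) :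
    ∃ t ∈ Set.Icc 0 T, dist (c t) (α.toFun u) ≤ fellowBound L A J := by
  have hZ := α.contracting.1
  have hJ0 : 0 ≤ J := dist_nonneg.trans hs
  set m := morseBound L A J with hm
  have hJm : J ≤ m := le_morseBound hL hA hJ0
  have h0J : Metric.infDist (c 0) α.image ≤ J := by
    rw [Ray.image, infDist_image_eq_zero Set.self_mem_Ici (α.base.trans h0.symm)]
    exact hJ0
  have hTJ : Metric.infDist (c T) α.image ≤ J :=
    (infDist_image_le_dist (hu.trans hus) _).trans hs
  have hmorse := fun t ht => infDist_le_morseBound hZ hρ hL hA hJ hc hq h0J hTJ (t := t) ht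
  have hclosed : ∀ S : Set X,
      IsClosed (Set.Icc 0 T ∩ (fun t => Metric.infDist (c t) S) ⁻¹' Set.Iic m) := fun S =>
    (continuousOn_infDist hc S).preimage_isClosed_of_isClosed isClosed_Icc isClosed_Iic
  have hne₁ : (α.toFun '' Set.Icc 0 u).Nonempty := ⟨_, 0, ⟨le_rfl, hu⟩, rfl⟩
  have hne₂ : (α.toFun '' Set.Ici u).Nonempty := ⟨_, u, Set.self_mem_Ici, rfl⟩
  -- By connectedness some time is close both to α up to u and to α from u on. The two nearby points
  -- of α straddle α(u) and are within 2 (m + 1) of each other, so α(u) is within 3 (m + 1).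
  obtain ⟨t, ht, ht₁, ht₂⟩ := isPreconnected_closed_iff.1 (isPreconnected_Icc (a := (0 : ℝ)) (b := T))
    _ _ (hclosed (α.toFun '' Set.Icc 0 u)) (hclosed (α.toFun '' Set.Ici u))
    (fun t ht => by
      obtain ⟨_, ⟨v, hv, rfl⟩, hd⟩ := hZ (c t)
      have hle := hd.trans_le (hmorse t ht)
      rcases le_total v u with h | h
      · exact Or.inl ⟨ht, (infDist_image_le_dist (Set.mem_Icc.2 ⟨hv, h⟩) _).trans hle⟩
      · exact Or.inr ⟨ht, (infDist_image_le_dist h _).trans hle⟩)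
    ⟨0, ⟨le_rfl, hT⟩, ⟨le_rfl, hT⟩, by
      rw [Set.mem_preimage, infDist_image_eq_zero (Set.left_mem_Icc.2 hu) (α.base.trans h0.symm)]
      exact hJ0.trans hJm⟩
    ⟨T, ⟨hT, le_rfl⟩, ⟨hT, le_rfl⟩,
      (infDist_image_le_dist hus _).trans (hs.trans hJm)⟩
  obtain ⟨_, ⟨v, hv, rfl⟩, h1⟩ :=
    (Metric.infDist_lt_iff hne₁).1 (lt_of_le_of_lt (Set.mem_Iic.1 ht₁.2) (lt_add_one m))
  obtain ⟨_, ⟨w, hw, rfl⟩, h2⟩ :=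
    (Metric.infDist_lt_iff hne₂).1 (lt_of_le_of_lt (Set.mem_Iic.1 ht₂.2) (lt_add_one m))
  refine ⟨t, ht, ?_⟩
  have hw' : u ≤ w := hw
  have h3 := hα v hv.1 w (hu.trans hw)
  have h4 := hα w (hu.trans hw) u hu
  have h5 := dist_triangle_left (α.toFun v) (α.toFun w) (c t)
  have h6 := dist_triangle (c t) (α.toFun w) (α.toFun u)
  rw [abs_sub_comm, abs_of_nonneg (sub_nonneg.2 (hv.2.trans hw'))] at h3
  rw [abs_of_nonneg (sub_nonneg.2 hw')] at h4
  unfold fellowBound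
  linarith [hv.2]

/-- The loss in position along a ray when passing from closeness to `κ`-closeness. -/
def nearBound (L A κ J : ℝ) : ℝ := κ + (L * (8 * L * (κ + J + A)) + A) + J

/-- A quasi-geodesic from the base point that passes near a point of a contracting geodesic ray
passes `κ`-close to a point of the ray which is not much closer to the base point. -/
theorem exists_dist_le_of_near {o : X} {α : Ray X o} (hα : α.IsGeodesic) {ρ : ℝ → ℝ}
    (hρ : IsContractingWith ρ α.image) {L A κ J : ℝ} (hL : 1 ≤ L) (hA : 0 ≤ A)
    (hκ : Admissible ρ L A κ) {c : ℝ → X} {T : ℝ} (hT : 0 ≤ T) (h0 : c 0 = o)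
    (hc : ContinuousOn c (Set.Icc 0 T)) (hq : IsQuasiGeodesicOn L A c (Set.Icc 0 T)) {u : ℝ}
    (hu : 0 ≤ u) (hJ : dist (c T) (α.toFun u) ≤ J) :
    ∃ t ∈ Set.Icc 0 T, ∃ v, 0 ≤ v ∧ dist (c t) (α.toFun v) ≤ κ ∧ u - nearBound L A κ J ≤ v := by
  have hZ := α.contracting.1
  have hκ0 : 0 ≤ κ := le_trans (by positivity) hκ.multiplicative
  obtain ⟨t, ht, htκ, htT⟩ := exists_infDist_le_of_excursion hZ hρ hL hA hκ hT hc hq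
    (by rw [infDist_image_eq_zero Set.self_mem_Ici (α.base.trans h0.symm)]; exact hκ0)
    ((infDist_image_le_dist hu _).trans hJ)
  obtain ⟨_, ⟨v, hv, rfl⟩, hd⟩ := hZ (c t)
  have hle : dist (c t) (α.toFun v) ≤ κ := hd.trans_le htκ
  refine ⟨t, ht, v, hv, hle, ?_⟩
  have h1 := (hq.le_of_le hL ht ⟨hT, le_rfl⟩ ht.2).2
  have h2 := dist_triangle4 (α.toFun u) (c T) (c t) (α.toFun v)
  rw [hα u hu v hv, dist_comm _ (c T), dist_comm (c T) (c t)] at h2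
  have h3 : L * (T - t) ≤ L * (8 * L * (κ + J + A)) := mul_le_mul_of_nonneg_left htT (by linarith)
  have h4 := le_abs_self (u - v)
  unfold nearBound
  linarith

theorem setDist_le_of_dist_le {S T : Set X} {x y : X} {k : ℝ} (hx : x ∈ S) (hy : y ∈ T)
    (h : dist x y ≤ k) : setDist S T ≤ ENNReal.ofReal k :=
  (iInf₂_le x hx).trans ((Metric.infEDist_le_edist_of_mem hy).trans
    (by rw [edist_dist]; exact ENNReal.ofReal_le_ofReal h))

theorem exists_dist_lt_of_setDist_le {S T : Set X} {k : ℝ} (hk : 0 ≤ k)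
    (h : setDist S T ≤ ENNReal.ofReal k) : ∃ x ∈ S, ∃ y ∈ T, dist x y < k + 1 := by
  have h1 : setDist S T < ENNReal.ofReal (k + 1) :=
    h.trans_lt ((ENNReal.ofReal_lt_ofReal_iff (by linarith)).2 (lt_add_one k))
  simp only [setDist, iInf_lt_iff] at h1
  obtain ⟨x, hx, h2⟩ := h1
  obtain ⟨y, hy, h3⟩ := Metric.infEDist_lt_iff.1 h2
  refine ⟨x, hx, y, hy, ?_⟩
  rw [edist_dist] at h3
  exact (ENNReal.ofReal_lt_ofReal_iff (by linarith)).1 h3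

/-! ### Concatenation of quasi-geodesics and extension to rays -/

/-- The concatenation at time `a` of the paths `c` and `g`. -/
noncomputable def concat {X : Type*} (a : ℝ) (c g : ℝ → X) (t : ℝ) : X := if t ≤ a then c t else g t

theorem concat_of_le {X : Type*} {a : ℝ} {c g : ℝ → X} {t : ℝ} (h : t ≤ a) : concat a c g t = c t := if_pos h

theorem concat_of_ge {X : Type*} {a : ℝ} {c g : ℝ → X} {t : ℝ} (hcg : c a = g a) (h : a ≤ t) :
    concat a c g t = g t := by
  rcases h.eq_or_lt with rfl | h
  · rw [concat_of_le le_rfl, hcg]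
  · exact if_neg (not_le.2 h)

theorem continuousOn_concat {a : ℝ} {c g : ℝ → X} {I : Set ℝ} (hI : IsClosed I) (hcg : c a = g a)
    (hc : ContinuousOn c (I ∩ Set.Iic a)) (hg : ContinuousOn g (I ∩ Set.Ici a)) :
    ContinuousOn (concat a c g) I := by
  have : I = (I ∩ Set.Iic a) ∪ (I ∩ Set.Ici a) := by
    rw [← Set.inter_union_distrib_left, Set.Iic_union_Ici, Set.inter_univ]
  rw [this]
  exact (hc.congr fun t ht => concat_of_le ht.2).union_of_isClosed
    (hg.congr fun t ht => concat_of_ge hcg ht.2) (hI.inter isClosed_Iic) (hI.inter isClosed_Ici)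

theorem isQuasiGeodesicOn_of_le {L A : ℝ} {c : ℝ → X} {I : Set ℝ}
    (h : ∀ s ∈ I, ∀ t ∈ I, s ≤ t → 1 / L * (t - s) - A ≤ dist (c s) (c t) ∧
      dist (c s) (c t) ≤ L * (t - s) + A) : IsQuasiGeodesicOn L A c I := by
  intro s hs t ht
  rcases le_total s t with hst | hst
  · rw [abs_sub_comm, abs_of_nonneg (sub_nonneg.2 hst)]
    exact h s hs t ht hst
  · rw [abs_of_nonneg (sub_nonneg.2 hst), dist_comm]
    exact h t ht s hs hst

/-- The upper bound across the join follows from the triangle inequality and the additive errors add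
up; only the lower bound across the join needs a hypothesis. -/
theorem isQuasiGeodesicOn_concat {L A B a : ℝ} {c g : ℝ → X} {I : Set ℝ} (hA : 0 ≤ A) (hB : 0 ≤ B)
    (ha : a ∈ I) (hcg : c a = g a) (hc : IsQuasiGeodesicOn L A c (I ∩ Set.Iic a))
    (hg : IsQuasiGeodesicOn L B g (I ∩ Set.Ici a))
    (h : ∀ s ∈ I, s ≤ a → ∀ t ∈ I, a ≤ t → 1 / L * (t - s) - (A + B) ≤ dist (c s) (g t)) :
    IsQuasiGeodesicOn L (A + B) (concat a c g) I := by
  refine isQuasiGeodesicOn_of_le fun s hs t ht hst => ?_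
  rcases le_total t a with hta | hta
  · rw [concat_of_le (hst.trans hta), concat_of_le hta]
    have := hc s ⟨hs, hst.trans hta⟩ t ⟨ht, hta⟩
    rw [abs_sub_comm, abs_of_nonneg (sub_nonneg.2 hst)] at this
    exact ⟨by linarith [this.1], by linarith [this.2]⟩
  · rcases le_total s a with hsa | hsa
    · rw [concat_of_le hsa, concat_of_ge hcg hta]
      refine ⟨h s hs hsa t ht hta, ?_⟩
      have h1 := (hc s ⟨hs, hsa⟩ a ⟨ha, Set.mem_Iic.2 le_rfl⟩).2
      have h2 := (hg a ⟨ha, Set.mem_Ici.2 le_rfl⟩ t ⟨ht, hta⟩).2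
      rw [abs_sub_comm, abs_of_nonneg (sub_nonneg.2 hsa)] at h1
      rw [abs_sub_comm, abs_of_nonneg (sub_nonneg.2 hta)] at h2
      have h3 := dist_triangle (c s) (c a) (g t)
      rw [hcg] at h3 h1
      linarith
    · rw [concat_of_ge hcg hsa, concat_of_ge hcg hta]
      have := hg s ⟨hs, hsa⟩ t ⟨ht, hta⟩
      rw [abs_sub_comm, abs_of_nonneg (sub_nonneg.2 hst)] at this
      exact ⟨by linarith [this.1], by linarith [this.2]⟩

theorem IsQuasiGeodesicOn.comp_add_const {L A : ℝ} {c : ℝ → X} {I J : Set ℝ}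
    (h : IsQuasiGeodesicOn L A c I) (d : ℝ) (hJ : ∀ t ∈ J, t + d ∈ I) :
    IsQuasiGeodesicOn L A (fun t => c (t + d)) J := fun s hs t ht => by
  simpa using h _ (hJ s hs) _ (hJ t ht)

theorem _root_.ContinuousOn.comp_add_const {c : ℝ → X} {I J : Set ℝ}
    (h : ContinuousOn c I) (d : ℝ) (hJ : ∀ t ∈ J, t + d ∈ I) :
    ContinuousOn (fun t => c (t + d)) J :=
  h.comp (continuous_id.add continuous_const).continuousOn hJ

/-- Serves to compare a spliced path with a ray having the same tail U. -/
theorem exists_isNear_of_bounded_union {S T S₀ T₀ U : Set X} (hS : S.Nonempty) (hT : T.Nonempty)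
    (hS₀ : Bornology.IsBounded S₀) (hT₀ : Bornology.IsBounded T₀) (hSU : S ⊆ S₀ ∪ U)
    (hTU : T ⊆ T₀ ∪ U) (hUS : U ⊆ S) (hUT : U ⊆ T) : ∃ C, 0 ≤ C ∧ IsNear C S T := by
  obtain ⟨p, hp⟩ := hS
  obtain ⟨q, hq⟩ := hT
  obtain ⟨C, hC⟩ := hS₀.subset_closedBall q
  obtain ⟨D, hD⟩ := hT₀.subset_closedBall p
  refine ⟨max 0 (max C D), le_max_left _ _, fun x hx => ?_, fun x hx => ?_⟩
  · rcases hSU hx with h | h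
    · exact ⟨q, hq, (Metric.mem_closedBall.1 (hC h)).trans ((le_max_left _ _).trans (le_max_right _ _))⟩
    · exact ⟨x, hUT h, by simp⟩
  · rcases hTU hx with h | h
    · exact ⟨p, hp, (Metric.mem_closedBall.1 (hD h)).trans ((le_max_right _ _).trans (le_max_right _ _))⟩
    · exact ⟨x, hUS h, by simp⟩

/-- Near-minimisers of `(t, s) ↦ t / (2 L) + d (c t, α s) - s / 2`. -/
theorem exists_near_minimiser {L A : ℝ} (hL : 1 ≤ L) {c : ℝ → X} {T : ℝ} (hT : 0 ≤ T)
    (hq : IsQuasiGeodesicOn L A c (Set.Icc 0 T)) {α : Ray X (c 0)} (hα : α.IsGeodesic) {S₀ : ℝ}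
    (hS₀ : 0 ≤ S₀) :
    ∃ p ∈ Set.Icc 0 T, ∃ q, S₀ ≤ q ∧ ∀ t ∈ Set.Icc 0 T, ∀ s, S₀ ≤ s →
      p / (2 * L) + dist (c p) (α.toFun q) - q / 2 ≤
        t / (2 * L) + dist (c t) (α.toFun s) - s / 2 + 1 := by
  have hL0 : 0 < L := by linarith
  set E : Set ℝ := {e | ∃ t ∈ Set.Icc 0 T, ∃ s, S₀ ≤ s ∧
    e = t / (2 * L) + dist (c t) (α.toFun s) - s / 2} with hE
  have hne : E.Nonempty := ⟨_, 0, ⟨le_rfl, hT⟩, S₀, le_rfl, rfl⟩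
  have hbdd : BddBelow E := by
    refine ⟨-(L * T + A), ?_⟩
    rintro _ ⟨t, ht, s, hs, rfl⟩
    have h1 := (hq.le_of_le hL ⟨le_rfl, hT⟩ ht ht.1).2
    have h2 := dist_triangle (c 0) (c t) (α.toFun s)
    rw [hα.dist_base (hS₀.trans hs)] at h2
    have h3 : 0 ≤ t / (2 * L) := div_nonneg ht.1 (by positivity)
    have h4 : L * (t - 0) ≤ L * T := mul_le_mul_of_nonneg_left (by linarith [ht.2]) hL0.le
    linarith
  obtain ⟨_, ⟨p, hp, q, hq', rfl⟩, hlt⟩ := exists_lt_of_csInf_lt hne (lt_add_one (sInf E))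
  refine ⟨p, hp, q, hq', fun t ht s hs => ?_⟩
  have := csInf_le hbdd (show _ ∈ E from ⟨t, ht, s, hs, rfl⟩)
  linarith

/-- Concatenation of `c` up to time `p`, a geodesic of length `d` to `α q`, and the tail of `α`
from `q` on. -/
noncomputable def detour (p d q : ℝ) (c g α : ℝ → X) : ℝ → X :=
  concat p c (concat (p + d) (fun t => g (t + -p)) fun t => α (t + (q - p - d)))

/-- The inequality `hmin` is near-minimality of the functional in `exists_near_minimiser`, written
with s = q + u. It is the lower bound between c and the tail of α; subtracting a piece of g from it
gives the lower bounds at the two corners. The slopes 1 / (2 L) and 1 / 2 in the functional account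
for the constant 2 L, its error 1 for A + 1. -/
theorem detour_spec {L A : ℝ} (hL : 1 ≤ L) (hA : 0 ≤ A) {c : ℝ → X} {p : ℝ} (hp : 0 ≤ p)
    (hc : ContinuousOn c (Set.Icc 0 p)) (hq : IsQuasiGeodesicOn L A c (Set.Icc 0 p))
    {α : ℝ → X} (hα : ∀ s ∈ Set.Ici (0 : ℝ), ∀ t ∈ Set.Ici (0 : ℝ), dist (α s) (α t) = |s - t|)
    {q d : ℝ} (hq0 : 0 ≤ q) (hd : dist (c p) (α q) = d) {g : ℝ → X} (hg0 : g 0 = c p)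
    (hgd : g d = α q)
    (hg : ∀ s ∈ Set.Icc 0 d, ∀ t ∈ Set.Icc 0 d, dist (g s) (g t) = |s - t|)
    (hmin : ∀ t ∈ Set.Icc 0 p, ∀ u, 0 ≤ u →
      d + (p - t) / (2 * L) + u / 2 - 1 ≤ dist (c t) (α (q + u))) :
    ContinuousOn (detour p d q c g α) (Set.Ici 0) ∧
      IsQuasiGeodesicOn (2 * L) (A + 1) (detour p d q c g α) (Set.Ici 0) ∧
      (∀ t ≤ p, detour p d q c g α t = c t) ∧
      ∀ t, p + d ≤ t → detour p d q c g α t = α (t + (q - p - d)) := by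
  have hL0 : 0 < L := by linarith
  have hd0 : 0 ≤ d := hd ▸ dist_nonneg
  set g' : ℝ → X := fun t => g (t + -p) with hg'
  set α' : ℝ → X := fun t => α (t + (q - p - d)) with hα'
  have hjoin₂ : g' (p + d) = α' (p + d) := by
    simp only [hg', hα']
    rw [show p + d + -p = d by ring, hgd, show p + d + (q - p - d) = q by ring]
  have hjoin₁ : c p = concat (p + d) g' α' p := by
    rw [concat_of_le (by linarith)]
    simp only [hg']
    rw [add_neg_cancel, hg0]
  have hIcc : ∀ t ∈ Set.Ici p ∩ Set.Iic (p + d), t + -p ∈ Set.Icc 0 d := fun t ht =>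
    ⟨by linarith [Set.mem_Ici.1 ht.1], by linarith [Set.mem_Iic.1 ht.2]⟩
  have hIci : ∀ t ∈ Set.Ici p ∩ Set.Ici (p + d), t + (q - p - d) ∈ Set.Ici (0 : ℝ) :=
    fun t ht => Set.mem_Ici.2 (by linarith [Set.mem_Ici.1 ht.2])
  have hone : (1 : ℝ) ≤ 2 * L := by linarith
  have hp' : ∀ t ∈ Set.Ici (0 : ℝ) ∩ Set.Iic p, t ∈ Set.Icc 0 p := fun t ht => ht
  have hc₂ : ContinuousOn (concat (p + d) g' α') (Set.Ici p) :=
    continuousOn_concat isClosed_Ici hjoin₂ ((continuousOn_of_isometric hg).comp_add_const _ hIcc)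
      ((continuousOn_of_isometric hα).comp_add_const _ hIci)
  have hinv : 1 / (2 * L) ≤ 1 / 2 := one_div_le_one_div_of_le (by norm_num) (by linarith)
  have hinv0 : 0 < 1 / (2 * L) := by positivity
  have hgα : ∀ v ∈ Set.Icc 0 d, dist (g v) (α q) = d - v := fun v hv => by
    rw [← hgd, hg v hv d ⟨hd0, le_rfl⟩, abs_sub_comm, abs_of_nonneg (sub_nonneg.2 hv.2)]
  have hgc : ∀ v ∈ Set.Icc 0 d, dist (c p) (g v) = v := fun v hv => by
    rw [← hg0, hg 0 ⟨le_rfl, hd0⟩ v hv, zero_sub, abs_neg, abs_of_nonneg hv.1]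
  have hq₂ : IsQuasiGeodesicOn (2 * L) 1 (concat (p + d) g' α') (Set.Ici p) := by
    have h1 : IsQuasiGeodesicOn (2 * L) 1 g' (Set.Ici p ∩ Set.Iic (p + d)) :=
      ((isQuasiGeodesicOn_of_isometric hg).comp_add_const _ hIcc).weaken le_rfl hone zero_le_one
    have h2 : IsQuasiGeodesicOn (2 * L) 0 α' (Set.Ici p ∩ Set.Ici (p + d)) :=
      ((isQuasiGeodesicOn_of_isometric hα).comp_add_const _ hIci).weaken le_rfl hone le_rfl
    have h3 := isQuasiGeodesicOn_concat zero_le_one le_rfl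
      (show p + d ∈ Set.Ici p from Set.mem_Ici.2 (by linarith)) hjoin₂ h1 h2
      (fun s hs hs' t ht ht' => by
        have h4 := hmin p ⟨hp, le_rfl⟩ (t - p - d) (by linarith)
        have h5 := dist_triangle (c p) (g (s + -p)) (α (q + (t - p - d)))
        rw [hgc _ (hIcc s ⟨hs, hs'⟩), show q + (t - p - d) = t + (q - p - d) by ring] at h5
        rw [show q + (t - p - d) = t + (q - p - d) by ring, sub_self, zero_div] at h4
        simp only [hg', hα']
        have h6 : 1 / (2 * L) * (t - s) ≤ 1 / 2 * (t - s) :=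
          mul_le_mul_of_nonneg_right hinv (by linarith)
        linarith)
    rwa [add_zero] at h3
  refine ⟨continuousOn_concat isClosed_Ici hjoin₁ (hc.mono hp')
      (hc₂.mono Set.inter_subset_right),
    isQuasiGeodesicOn_concat hA zero_le_one hp hjoin₁
      ((hq.mono hp').weaken hL (by linarith) le_rfl) (hq₂.mono Set.inter_subset_right) ?_,
    fun t ht => concat_of_le ht, fun t ht => ?_⟩
  · intro s hs hsp t ht hpt
    have hs' : s ∈ Set.Icc 0 p := ⟨hs, hsp⟩
    rcases le_total t (p + d) with h | h
    · rw [concat_of_le h]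
      have h4 := hmin s hs' 0 le_rfl
      have h5 := dist_triangle (c s) (g' t) (α q)
      have h6 := hgα _ (hIcc t ⟨hpt, h⟩)
      have h7 : 1 / (2 * L) * (t - s) = 1 / (2 * L) * (t - p) + (p - s) / (2 * L) := by ring
      have h8 : 1 / (2 * L) * (t - p) ≤ 1 / 2 * (t - p) :=
        mul_le_mul_of_nonneg_right hinv (by linarith)
      rw [add_zero] at h4
      simp only [hg'] at h5 ⊢
      linarith
    · rw [concat_of_ge hjoin₂ h]
      have h4 := hmin s hs' (t - p - d) (by linarith)
      rw [show q + (t - p - d) = t + (q - p - d) by ring] at h4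
      have h7 : 1 / (2 * L) * (t - s) = 1 / (2 * L) * (t - p) + (p - s) / (2 * L) := by ring
      have h8 : 1 / (2 * L) * (t - p) ≤ 1 / 2 * (t - p) :=
        mul_le_mul_of_nonneg_right hinv (by linarith)
      simp only [hα']
      linarith
  · rw [detour, concat_of_ge hjoin₁ (by linarith), concat_of_ge hjoin₂ ht]

/-- How far along a geodesic ray one has to go so that `exists_ray_extension` applies. -/
noncomputable def extensionBound (L A K R : ℝ) : ℝ :=
  2 * (A + ((3 * K + A) / 2 + 1) + L * (2 * L * (R + A + 1))) + 1

/-- If a quasi-geodesic `c` comes close to a far away point of a geodesic ray `α`, an initial part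
of `c` extends to a quasi-geodesic ray in the class of `α`, with control of the constants. -/
theorem exists_ray_extension [ProperSpace X] (hX : IsGeodesicSpace X) {o : X} {α : Ray X o}
    (hα : α.IsGeodesic) {L A K R : ℝ} (hL : 1 ≤ L) (hA : 0 ≤ A) (hR : 0 ≤ R) {c : ℝ → X} {T : ℝ}
    (hT : 0 ≤ T) (h0 : c 0 = o) (hc : ContinuousOn c (Set.Icc 0 T))
    (hq : IsQuasiGeodesicOn L A c (Set.Icc 0 T)) {s₀ : ℝ} (hs₀ : extensionBound L A K R ≤ s₀)
    (hK : dist (c T) (α.toFun s₀) ≤ K) :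
    ∃ β : Ray X o, β.toBoundary = α.toBoundary ∧ ContinuousOn β.toFun (Set.Ici 0) ∧
      IsQuasiGeodesicOn (2 * L) (A + 1) β.toFun (Set.Ici 0) ∧
      ∃ p ∈ Set.Icc 0 T, (∀ t ≤ p, β.toFun t = c t) ∧ ∀ t, p ≤ t → R < dist o (β.toFun t) := by
  subst h0
  have hL0 : 0 < L := by linarith
  have hK0 : 0 ≤ K := dist_nonneg.trans hK
  set S₀ := extensionBound L A K R with hS
  have hS₀ : 0 ≤ S₀ := by unfold extensionBound at hS; rw [hS]; positivity
  obtain ⟨p, hp, q, hq', hmin⟩ := exists_near_minimiser hL hT hq hα hS₀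
  have hq0 : 0 ≤ q := hS₀.trans hq'
  obtain ⟨g, hg0, hgd, hg⟩ := hX (c p) (α.toFun q)
  set d := dist (c p) (α.toFun q) with hd
  have hd0 : 0 ≤ d := dist_nonneg
  have hsub : Set.Icc 0 p ⊆ Set.Icc 0 T := Set.Icc_subset_Icc_right hp.2
  obtain ⟨hβc, hβq, hβp, hβα⟩ := detour_spec hL hA hp.1 (hc.mono hsub) (hq.mono hsub) hα hq0
    hd.symm hg0 hgd hg (fun t ht u hu => by
      have := hmin t (hsub ht) (q + u) (by linarith)
      have h1 : (p - t) / (2 * L) = p / (2 * L) - t / (2 * L) := by ring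
      linarith)
  set b := detour p d q c g α.toFun with hb
  have hb0 : b 0 = c 0 := hβp 0 hp.1
  obtain ⟨C, -, hn⟩ : ∃ C, 0 ≤ C ∧ IsNear C (b '' Set.Ici 0) α.image := by
    refine exists_isNear_of_bounded_union ⟨_, 0, Set.self_mem_Ici, rfl⟩ ⟨_, 0, Set.self_mem_Ici, rfl⟩
      (S₀ := b '' Set.Icc 0 (p + d)) (T₀ := α.toFun '' Set.Icc 0 q) (U := α.toFun '' Set.Ici q)
      (isCompact_Icc.image_of_continuousOn (hβc.mono fun t ht => ht.1)).isBounded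
      (isCompact_Icc.image_of_continuousOn
        ((continuousOn_of_isometric hα).mono fun t ht => ht.1)).isBounded ?_ ?_ ?_ ?_
    · rintro _ ⟨t, ht, rfl⟩
      rcases le_total t (p + d) with h | h
      · exact Or.inl ⟨t, ⟨ht, h⟩, rfl⟩
      · exact Or.inr ⟨t + (q - p - d), Set.mem_Ici.2 (by linarith), (hβα t h).symm⟩
    · rintro _ ⟨t, ht, rfl⟩
      rcases le_total t q with h | h
      · exact Or.inl ⟨t, ⟨ht, h⟩, rfl⟩
      · exact Or.inr ⟨t, h, rfl⟩
    · rintro _ ⟨t, ht, rfl⟩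
      have ht' : q ≤ t := ht
      refine ⟨t - (q - p - d), Set.mem_Ici.2 (by linarith [hp.1]), ?_⟩
      rw [hβα _ (by linarith), sub_add_cancel]
    · rintro _ ⟨t, ht, rfl⟩
      exact ⟨t, hq0.trans (Set.mem_Ici.1 ht), rfl⟩
  obtain ⟨β, hβ, hβζ⟩ := exists_ray hX (by linarith : 1 ≤ 2 * L) (by linarith : 0 ≤ A + 1) hb0 hβc
    hβq ⟨α, rfl, hn.hausdorffEDist_ne_top⟩
  refine ⟨β, hβζ, hβ ▸ hβc, hβ ▸ hβq, p, hp, hβ ▸ hβp, fun t ht => ?_⟩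
  rw [hβ]
  have h1 := (hβq.le_of_le (by linarith) Set.self_mem_Ici (hp.1.trans ht) (hp.1.trans ht)).1
  rw [hb0] at h1
  -- Comparison with the pair (T, s₀): the length of c up to T contributes at most about s₀ / 2,
  -- which cancels against - s₀ / 2. The bound left is (3 K + A) / 2 + 1, independent of s₀. As q ≥
  -- S₀ is large and q ≤ L p + A + d, the splice time p must be large.
  have h2 := hmin T ⟨hT, le_rfl⟩ s₀ hs₀
  have h3 := (hq.le_of_le hL ⟨le_rfl, hT⟩ ⟨hT, le_rfl⟩ hT).1
  have h4 := (hq.le_of_le hL ⟨le_rfl, hT⟩ hp hp.1).2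
  have h5 := dist_triangle (c 0) (c p) (α.toFun q)
  rw [hα.dist_base hq0] at h5
  have h6 := dist_triangle (c 0) (α.toFun s₀) (c T)
  rw [hα.dist_base (hS₀.trans hs₀), dist_comm (α.toFun s₀)] at h6
  have h7 : T / (2 * L) ≤ (s₀ + K + A) / 2 := by
    rw [div_le_iff₀ (by positivity)]
    have : L * (dist (c 0) (c T) + A) ≤ L * (s₀ + K + A) :=
      mul_le_mul_of_nonneg_left (by linarith) hL0.le
    linarith
  have h8 : 0 ≤ p / (2 * L) := div_nonneg hp.1 (by positivity)
  have h9 : L * (2 * L * (R + A + 1)) < L * p := by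
    unfold extensionBound at hS
    linarith
  have h10 := lt_of_mul_lt_mul_left h9 hL0.le
  have h11 : 2 * L * (R + A + 1) < 2 * L * (dist (c 0) (b t) + (A + 1)) := by linarith
  linarith [lt_of_mul_lt_mul_left h11 (by positivity)]

/-! ### The sets Ū(ζ, r) are neighbourhoods -/

theorem exists_of_mem_farPart {o : X} {ζ : Boundary X o} (hα : (geodesicRay ζ).IsGeodesic)
    {r : ℝ} {y : X} (hy : y ∈ farPart ζ r) :
    ∃ s, 0 ≤ s ∧ r ≤ s ∧ y = (geodesicRay ζ).toFun s := by
  obtain ⟨⟨s, hs, rfl⟩, hr⟩ := hy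
  have hr' : r ≤ dist o ((geodesicRay ζ).toFun s) := hr
  rw [hα.dist_base hs] at hr'
  exact ⟨s, hs, hr', rfl⟩

theorem mem_farPart {o : X} {ζ : Boundary X o} (hα : (geodesicRay ζ).IsGeodesic)
    {r s : ℝ} (hs : 0 ≤ s) (hr : r ≤ s) : (geodesicRay ζ).toFun s ∈ farPart ζ r :=
  ⟨⟨s, hs, rfl⟩, by rw [Set.mem_ofPred_eq, hα.dist_base hs]; exact hr⟩

theorem le_of_kappa_lt {ρ : ℝ → ℝ} {L A r : ℝ} (hL : 1 ≤ L) (hr : 0 ≤ r) (h : kappa ρ L A < r) :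
    L ≤ r ∧ A ≤ r := by
  have h1 : 3 * A ≤ kappa ρ L A := le_max_left _ _
  have h2 : 3 * L ^ 2 ≤ kappa ρ L A := (le_max_left _ _).trans (le_max_right _ _)
  exact ⟨by nlinarith, by linarith⟩

theorem nearBound_mono {L L' A A' κ κ' J : ℝ} (hL : 0 ≤ L) (hLL : L ≤ L') (hA : 0 ≤ A)
    (hAA : A ≤ A') (hκ : 0 ≤ κ) (hκκ : κ ≤ κ') (hJ : 0 ≤ J) :
    nearBound L A κ J ≤ nearBound L' A' κ' J := by
  have hL' : 0 ≤ L' := hL.trans hLL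
  unfold nearBound
  gcongr

/-- The common conclusion for segments and rays: a quasi-geodesic from the base point that passes
near a far away point of `α^ζ` passes `κ`-close to the far part of `α^ζ`. -/
theorem setDist_farPart_le [ProperSpace X] (hX : IsGeodesicSpace X) {o : X} (ζ : Boundary X o)
    {r J u : ℝ} (hr : 1 ≤ r) (hu : r + nearBound r r r J ≤ u) {L A : ℝ} (hL : 1 ≤ L) (hA : 0 ≤ A)
    (hκ : kappa (rhoOf ζ) L A < r) {c : ℝ → X} {T : ℝ} (hT : 0 ≤ T) (h0 : c 0 = o)
    (hc : ContinuousOn c (Set.Icc 0 T)) (hq : IsQuasiGeodesicOn L A c (Set.Icc 0 T)) (hu0 : 0 ≤ u)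
    (hJ : dist (c T) ((geodesicRay ζ).toFun u) ≤ J) :
    setDist (c '' Set.Icc 0 T) (farPart ζ r) ≤ ENNReal.ofReal (kappa (rhoOf ζ) L A) := by
  obtain ⟨hα, hαζ⟩ := geodesicRay_spec hX ζ
  obtain ⟨hρ, -, hcon⟩ := rhoOf_spec hX ζ
  obtain ⟨hLr, hAr⟩ := le_of_kappa_lt hL (by linarith) hκ
  obtain ⟨t, ht, v, hv, hd, hle⟩ := exists_dist_le_of_near hα (hcon _ hα hαζ) hL hA
    (admissible_kappa hρ hL A) hT h0 hc hq hu0 hJ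
  have := nearBound_mono (J := J) (by linarith) hLr hA hAr (kappa_nonneg (rhoOf ζ) L A) hκ.le
    (dist_nonneg.trans hJ)
  exact setDist_le_of_dist_le ⟨t, ht, rfl⟩ (mem_farPart hα hv (by linarith)) hd

/-- The point o is at distance exactly r from α^ζ(r), so the closeness condition is vacuous once κ ≥
r. Only finitely bounded constants L, A remain. -/
theorem setDist_farPart_le_of_le_kappa [ProperSpace X] (hX : IsGeodesicSpace X) {o : X}
    (ζ : Boundary X o) {r k : ℝ} (hr : 0 ≤ r) (hk : r ≤ k) {S : Set X} (hS : o ∈ S) :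
    setDist S (farPart ζ r) ≤ ENNReal.ofReal k := by
  obtain ⟨hα, -⟩ := geodesicRay_spec hX ζ
  exact setDist_le_of_dist_le hS (mem_farPart hα hr le_rfl) ((hα.dist_base hr).trans_le hk)

/-- Closeness to the far part becomes closeness to the single point at height u, with a bound
depending only on the upper limits L', A' of the constants. The summand 1 compensates for the
infimum in `setDist` not being assumed attained. -/
theorem exists_dist_le_of_setDist_le [ProperSpace X] (hX : IsGeodesicSpace X) {o : X}
    (ζ : Boundary X o) {L A L' A' : ℝ} (hL : 1 ≤ L) (hL' : L ≤ L') (hA : 0 ≤ A) (hA' : A ≤ A')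
    {c : ℝ → X} {I : Set ℝ} (hI : I.OrdConnected) (hI0 : (0 : ℝ) ∈ I) (hI' : I ⊆ Set.Ici 0)
    (h0 : c 0 = o) (hc : ContinuousOn c I) (hq : IsQuasiGeodesicOn L A c I) {u R : ℝ}
    (hu : 0 ≤ u) (huR : u ≤ R)
    (h : setDist (c '' I) (farPart ζ R) ≤ ENNReal.ofReal (kappa (rhoOf ζ) L A)) :
    ∃ t ∈ I, dist (c t) ((geodesicRay ζ).toFun u) ≤
      fellowBound L' A' (kappa (rhoOf ζ) L' A' + 1) := by
  obtain ⟨hα, hαζ⟩ := geodesicRay_spec hX ζ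
  obtain ⟨hρ, hρ0, hcon⟩ := rhoOf_spec hX ζ
  obtain ⟨_, ⟨T, hT, rfl⟩, y, hy, hd⟩ := exists_dist_lt_of_setDist_le (kappa_nonneg _ _ _) h
  obtain ⟨s, hs, hRs, rfl⟩ := exists_of_mem_farPart hα hy
  have hsub : Set.Icc 0 T ⊆ I := hI.out hI0 hT
  obtain ⟨t, ht, hle⟩ := exists_dist_le_fellowBound hα (hcon _ hα hαζ) (hL.trans hL')
    (hA.trans hA') ((admissible_kappa hρ (hL.trans hL') A').mono (le_add_of_nonneg_right zero_le_one))
    (hI' hT) h0 (hc.mono hsub) ((hq.mono hsub).weaken hL hL' hA') hu (huR.trans hRs)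
    (hd.le.trans (by linarith [kappa_mono hρ hρ0 hL hL' hA']))
  exact ⟨t, hsub ht, hle⟩

/-- A tail of length at most 1 costs at most 1 in distance and at most 1 in parameter time. -/
theorem isQuasiGeodesicOn_append {L A : ℝ} (hL : 1 ≤ L) (hA : 0 ≤ A) {c : ℝ → X} {T : ℝ}
    (hT : 0 ≤ T) (hc : ContinuousOn c (Set.Icc 0 T)) (hq : IsQuasiGeodesicOn L A c (Set.Icc 0 T))
    {d : ℝ} (hd : 0 ≤ d) (hd1 : d ≤ 1) {g : ℝ → X} (hg0 : g 0 = c T)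
    (hg : ∀ s ∈ Set.Icc 0 d, ∀ t ∈ Set.Icc 0 d, dist (g s) (g t) = |s - t|) :
    ContinuousOn (concat T c fun t => g (t + -T)) (Set.Icc 0 (T + d)) ∧
      IsQuasiGeodesicOn L (A + 2) (concat T c fun t => g (t + -T)) (Set.Icc 0 (T + d)) := by
  have hL0 : 0 < L := by linarith
  have hjoin : c T = (fun t => g (t + -T)) T := by simp [hg0]
  have h1 : Set.Icc 0 (T + d) ∩ Set.Iic T ⊆ Set.Icc 0 T := fun t ht => ⟨ht.1.1, ht.2⟩
  have h2 : ∀ t ∈ Set.Icc 0 (T + d) ∩ Set.Ici T, t + -T ∈ Set.Icc 0 d := fun t ht =>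
    ⟨by linarith [Set.mem_Ici.1 ht.2], by linarith [ht.1.2]⟩
  refine ⟨continuousOn_concat isClosed_Icc hjoin (hc.mono h1)
      ((continuousOn_of_isometric hg).comp_add_const _ h2),
    isQuasiGeodesicOn_concat hA zero_le_two ⟨hT, by linarith⟩ hjoin (hq.mono h1)
      (((isQuasiGeodesicOn_of_isometric hg).comp_add_const _ h2).weaken le_rfl hL zero_le_two) ?_⟩
  intro s hs hsT t ht hTt
  have h3 := (hq s ⟨hs.1, hsT⟩ T ⟨hT, le_rfl⟩).1
  rw [abs_sub_comm, abs_of_nonneg (sub_nonneg.2 hsT)] at h3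
  have h4 := dist_triangle_right (c s) (c T) (g (t + -T))
  have h5 := hg 0 ⟨le_rfl, hd⟩ _ (h2 t ⟨ht, hTt⟩)
  rw [hg0, zero_sub, abs_neg, abs_of_nonneg (h2 t ⟨ht, hTt⟩).1] at h5
  have h6 : 1 / L * (t - s) = 1 / L * (T - s) + 1 / L * (t - T) := by ring
  have h7 : 1 / L * (t - T) ≤ 1 * (t - T) :=
    mul_le_mul_of_nonneg_right ((div_le_one hL0).2 hL) (by linarith)
  have := ht.2
  linarith

/-- Points of `Ū(ζ, R)`, for large `R`, have a basic neighbourhood contained in `Ū(ζ, r)`. -/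
theorem exists_basic_nhds_subset [ProperSpace X] (hX : IsGeodesicSpace X) {o : X}
    (ζ : Boundary X o) {r : ℝ} (hr : 1 ≤ r) : ∃ R : ℝ, 1 ≤ R ∧
      (∀ x ∈ interiorNhd ζ R, Metric.ball x 1 ⊆ interiorNhd ζ r) ∧
      ∀ ω ∈ boundaryNhd ζ R, ∃ R' : ℝ, 1 ≤ R' ∧ bordNhd ω R' ⊆ bordNhd ζ r := by
  have hr0 : 0 ≤ r := by linarith
  -- The constants 2 r and r + 2 dominate both modified paths below: the appended segment, with (L,
  -- A + 2), and the extended ray, with (2 r, r + 1).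
  set J := fellowBound (2 * r) (r + 2) (kappa (rhoOf ζ) (2 * r) (r + 2) + 1) with hJ
  have hJ0 : 0 ≤ J := by
    have h1 := kappa_nonneg (rhoOf ζ) (2 * r) (r + 2)
    have h2 := le_morseBound (show 1 ≤ 2 * r by linarith) (show 0 ≤ r + 2 by linarith)
      (show 0 ≤ kappa (rhoOf ζ) (2 * r) (r + 2) + 1 by linarith)
    rw [hJ, fellowBound]
    linarith
  -- Passing from (J + 1)-closeness at height u to κ-closeness loses at most `nearBound`, so height
  -- r is kept. The 1 is for a passage on the appended segment, which is moved back to its start.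
  set u := r + nearBound r r r (J + 1) with hu
  have hru : r ≤ u := by
    have : 0 ≤ nearBound r r r (J + 1) := by unfold nearBound; positivity
    linarith
  refine ⟨u, hr.trans hru, fun x hx y hy => ?_, fun ω hω => ?_⟩
  · intro L A hL hA T c hT h0 hcT hc hq
    rcases le_or_gt r (kappa (rhoOf ζ) L A) with hk | hk
    · exact setDist_farPart_le_of_le_kappa hX ζ hr0 hk ⟨0, ⟨le_rfl, hT⟩, h0⟩
    obtain ⟨hLr, hAr⟩ := le_of_kappa_lt hL hr0 hk
    obtain ⟨g, hg0, hgd, hg⟩ := hX y x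
    have hy1 : dist y x ≤ 1 := (Metric.mem_ball.1 hy).le
    obtain ⟨hc', hq'⟩ := isQuasiGeodesicOn_append hL hA hT hc hq dist_nonneg hy1
      (hg0.trans hcT.symm) hg
    have hd0 : 0 ≤ dist y x := dist_nonneg
    have hjoin : c T = (fun t => g (t + -T)) T := by simp [hg0, hcT]
    have h0' : concat T c (fun t => g (t + -T)) 0 = o := by rw [concat_of_le hT, h0]
    obtain ⟨t, ht, hle⟩ := exists_dist_le_of_setDist_le hX ζ hL (show L ≤ 2 * r by linarith)
      (by linarith : 0 ≤ A + 2) (by linarith : A + 2 ≤ r + 2) Set.ordConnected_Icc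
      (Set.left_mem_Icc.2 (by linarith)) (fun t ht => ht.1) h0' hc' hq' (hr0.trans hru) le_rfl
      (hx L (A + 2) hL (by linarith) _ _ (by linarith) h0'
        (by rw [concat_of_ge hjoin (by linarith)]; simp [hgd]) hc' hq')
    obtain ⟨t', ht', hle'⟩ : ∃ t' ∈ Set.Icc 0 T,
        dist (c t') ((geodesicRay ζ).toFun u) ≤ J + 1 := by
      rcases le_total t T with h | h
      · rw [concat_of_le h] at hle
        exact ⟨t, ⟨ht.1, h⟩, hle.trans (by linarith)⟩
      · rw [concat_of_ge hjoin h] at hle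
        refine ⟨T, ⟨hT, le_rfl⟩, ?_⟩
        have h1 := hg 0 ⟨le_rfl, hd0⟩ (t + -T) ⟨by linarith, by linarith [ht.2]⟩
        rw [hg0, ← hcT, zero_sub, abs_neg, abs_of_nonneg (by linarith)] at h1
        have h2 := dist_triangle (c T) (g (t + -T)) ((geodesicRay ζ).toFun u)
        linarith [ht.2]
    have hsub : Set.Icc 0 t' ⊆ Set.Icc 0 T := Set.Icc_subset_Icc_right ht'.2
    exact (iInf_le_iInf_of_subset (Set.image_mono hsub)).trans
      (setDist_farPart_le hX ζ hr hu.ge hL hA hk ht'.1 h0 (hc.mono hsub) (hq.mono hsub)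
        (hr0.trans hru) hle')
  · obtain ⟨hω', hωω⟩ := geodesicRay_spec hX ω
    obtain ⟨hρ, hρ0, -⟩ := rhoOf_spec hX ω
    set K := kappa (rhoOf ω) r r + 1 with hK
    -- With radius u + J the extended ray is, after the splice, too far from o to be J-close to
    -- α^ζ(u); the passage near that point therefore belongs to the original path.
    refine ⟨max 1 (extensionBound r r K (u + J)), le_max_left _ _, ?_⟩
    have key : ∀ L A : ℝ, 1 ≤ L → 0 ≤ A → ∀ (c : ℝ → X) (I : Set ℝ), I.OrdConnected →
        (0 : ℝ) ∈ I → I ⊆ Set.Ici 0 → c 0 = o → ContinuousOn c I → IsQuasiGeodesicOn L A c I →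
        setDist (c '' I) (farPart ω (max 1 (extensionBound r r K (u + J)))) ≤
          ENNReal.ofReal (kappa (rhoOf ω) L A) →
        setDist (c '' I) (farPart ζ r) ≤ ENNReal.ofReal (kappa (rhoOf ζ) L A) := by
      intro L A hL hA c I hI hI0 hI' h0 hc hq hd
      rcases le_or_gt r (kappa (rhoOf ζ) L A) with hk | hk
      · exact setDist_farPart_le_of_le_kappa hX ζ hr0 hk ⟨0, hI0, h0⟩
      obtain ⟨hLr, hAr⟩ := le_of_kappa_lt hL hr0 hk
      obtain ⟨_, ⟨T, hT, rfl⟩, y, hy, hlt⟩ := exists_dist_lt_of_setDist_le (kappa_nonneg _ _ _) hd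
      obtain ⟨s, hs, hRs, rfl⟩ := exists_of_mem_farPart hω' hy
      have hT0 : 0 ≤ T := hI' hT
      have hsub : Set.Icc 0 T ⊆ I := hI.out hI0 hT
      obtain ⟨β, hβω, hβc, hβq, p, hp, hβp, hβR⟩ := exists_ray_extension hX hω' hr hr0
        (by linarith : 0 ≤ u + J) hT0 h0 (hc.mono hsub) ((hq.mono hsub).weaken hL hLr hAr)
        ((le_max_right _ _).trans hRs)
        (hlt.le.trans (by linarith [kappa_mono hρ hρ0 hL hLr hAr] : _ ≤ K))
      obtain ⟨t, ht, hle⟩ := exists_dist_le_of_setDist_le hX ζ (by linarith : 1 ≤ 2 * r) le_rfl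
        (by linarith : 0 ≤ r + 1) (by linarith : r + 1 ≤ r + 2) Set.ordConnected_Ici
        Set.self_mem_Ici subset_rfl β.base hβc hβq (hr0.trans hru) le_rfl
        (hω (2 * r) (r + 1) (by linarith) (by linarith) β (hβω.trans hωω) hβc hβq)
      have htp : t ≤ p := by
        by_contra! hlt
        have h1 := hβR t hlt.le
        have h2 := dist_triangle_right o (β.toFun t) ((geodesicRay ζ).toFun u)
        rw [(geodesicRay_spec hX ζ).1.dist_base (hr0.trans hru)] at h2
        linarith
      rw [hβp t htp] at hle
      have hsub' : Set.Icc 0 t ⊆ I := (Set.Icc_subset_Icc_right (htp.trans hp.2)).trans hsub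
      exact (iInf_le_iInf_of_subset (Set.image_mono hsub')).trans
        (setDist_farPart_le hX ζ hr hu.ge hL hA hk ht h0 (hc.mono hsub') (hq.mono hsub')
          (hr0.trans hru) (hle.trans (by linarith)))
    rintro _ (⟨y, hy, rfl⟩ | ⟨θ, hθ, rfl⟩)
    · refine Or.inl ⟨y, fun L A hL hA T c hT h0 hcT hc hq => ?_, rfl⟩
      exact key L A hL hA c _ Set.ordConnected_Icc (Set.left_mem_Icc.2 hT) (fun t ht => ht.1) h0 hc hq
        (hy L A hL hA T c hT h0 hcT hc hq)
    · refine Or.inr ⟨θ, fun L A hL hA β hβθ hc hq => ?_, rfl⟩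
      exact key L A hL hA β.toFun _ Set.ordConnected_Ici Set.self_mem_Ici subset_rfl β.base hc hq
        (hθ L A hL hA β hβθ hc hq)

/-- A ray of the class ζ returns to the κ-neighbourhood of α^ζ at arbitrarily late times. After time
L (r + κ + A) it is at distance at least r + κ from o, so the nearby point of α^ζ has height at
least r. -/
theorem self_mem_boundaryNhd [ProperSpace X] (hX : IsGeodesicSpace X) {o : X}
    (ζ : Boundary X o) (r : ℝ) : ζ ∈ boundaryNhd ζ r := by
  intro L A hL hA β hβ hc hq
  obtain ⟨hα, hαζ⟩ := geodesicRay_spec hX ζ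
  obtain ⟨hρ, -, hcon⟩ := rhoOf_spec hX ζ
  obtain ⟨C, -, hn⟩ := exists_isNear (toBoundary_eq_iff.1 (hβ.trans hαζ.symm))
  have hZ := (geodesicRay ζ).contracting.1
  set κ := kappa (rhoOf ζ) L A with hκ
  obtain ⟨t, ht, hd⟩ := exists_ge_infDist_le hZ (hcon _ hα hαζ) hL hA (admissible_kappa hρ hL A)
    hc hq (D := C) (fun t ht => by
      obtain ⟨_, ⟨v, hv, rfl⟩, h⟩ := hn.1 _ ⟨t, ht, rfl⟩
      exact (infDist_image_le_dist hv _).trans h) (le_max_left 0 (L * (r + κ + A)))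
  obtain ⟨_, ⟨v, hv, rfl⟩, hv'⟩ := hZ (β.toFun t)
  have hle : dist (β.toFun t) ((geodesicRay ζ).toFun v) ≤ κ := hv'.trans_le hd
  have ht0 : 0 ≤ t := (le_max_left _ _).trans ht
  refine setDist_le_of_dist_le ⟨t, ht0, rfl⟩ (mem_farPart hα hv ?_) hle
  have h1 := (hq.le_of_le hL Set.self_mem_Ici ht0 ht0).1
  rw [β.base] at h1
  have h2 := dist_triangle_right o (β.toFun t) ((geodesicRay ζ).toFun v)
  rw [hα.dist_base hv] at h2
  have h3 : L * (r + κ + A) ≤ L * (dist o (β.toFun t) + A) := by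
    linarith [(le_max_right 0 (L * (r + κ + A))).trans ht]
  linarith [le_of_mul_le_mul_left h3 (by linarith)]

/-- The sets `Ū(ζ, r)` are neighbourhoods of `ζ`. -/
theorem bordNhd_mem_nhds [ProperSpace X] (hX : IsGeodesicSpace X) {o : X} (ζ : Boundary X o)
    {r : ℝ} (hr : 1 ≤ r) : bordNhd ζ r ∈ 𝓝 (Bordification.ideal ζ) := by
  rw [mem_nhds_iff]
  -- The candidate open set consists of all points having a basic neighbourhood inside Ū(ζ, r). At a
  -- boundary point its openness is `exists_basic_nhds_subset`.
  refine ⟨{z | (∀ x, z = .inner x → ∃ ε > 0, Bordification.inner '' Metric.ball x ε ⊆ bordNhd ζ r) ∧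
    ∀ ω, z = .ideal ω → ∃ R : ℝ, 1 ≤ R ∧ bordNhd ω R ⊆ bordNhd ζ r}, ?_, ⟨?_, ?_⟩, ?_⟩
  · rintro (x | ω) ⟨h1, h2⟩
    · obtain ⟨ε, hε, h⟩ := h1 x rfl
      exact h ⟨x, Metric.mem_ball_self hε, rfl⟩
    · obtain ⟨R, -, h⟩ := h2 ω rfl
      exact h (Or.inr ⟨ω, self_mem_boundaryNhd hX ω R, rfl⟩)
  · intro x hx
    obtain ⟨ε, hε, h⟩ := hx.1 x rfl
    refine ⟨ε / 2, half_pos hε, ?_⟩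
    rintro _ ⟨y, hy, rfl⟩
    refine ⟨?_, fun ω hω => by cases hω⟩
    rintro z ⟨⟩
    refine ⟨ε / 2, half_pos hε, (Set.image_mono (Metric.ball_subset_ball' ?_)).trans h⟩
    linarith [Metric.mem_ball.1 hy]
  · intro ω hω
    obtain ⟨R, hR, h⟩ := hω.2 ω rfl
    obtain ⟨R', hR', h1, h2⟩ := exists_basic_nhds_subset hX ω hR
    refine ⟨R', hR', ?_⟩
    rintro _ (⟨x, hx, rfl⟩ | ⟨θ, hθ, rfl⟩)
    · refine ⟨?_, fun ω hω => by cases hω⟩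
      rintro z ⟨⟩
      exact ⟨1, one_pos, (Set.image_mono (h1 _ hx)).trans
        (Set.subset_union_left.trans h)⟩
    · refine ⟨fun x hx => (by cases hx), ?_⟩
      rintro z ⟨⟩
      obtain ⟨R'', hR'', h3⟩ := h2 _ hθ
      exact ⟨R'', hR'', h3.trans h⟩
  · refine ⟨fun x hx => (by cases hx), ?_⟩
    rintro z ⟨⟩
    exact ⟨r, hr, subset_rfl⟩

/-! ### Paths through an almost closest point -/

/-- A geodesic to an almost closest point of a quasi-geodesic, followed by a half of the
quasi-geodesic, is a quasi-geodesic. -/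
theorem concat_closest_spec {o : X} {γ : ℝ → X} {I J : Set ℝ} (hc : ContinuousOn γ I)
    (hq : IsQuasiGeodesicOn 3 0 γ I) {t₀ D : ℝ} (ht₀ : t₀ ∈ I) (hD0 : 0 ≤ D)
    (hmin : ∀ t ∈ I, D ≤ dist o (γ t) + 1) {g : ℝ → X} (hg0 : g 0 = o) (hgD : g D = γ t₀)
    (hg : ∀ s ∈ Set.Icc 0 D, ∀ t ∈ Set.Icc 0 D, dist (g s) (g t) = |s - t|)
    (hJ : IsClosed J) (hJ0 : J ⊆ Set.Ici 0) (hDJ : D ∈ J)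
    (hJI : ∀ t ∈ J, D ≤ t → t + (t₀ - D) ∈ I) :
    ContinuousOn (concat D g fun t => γ (t + (t₀ - D))) J ∧
      IsQuasiGeodesicOn 7 1 (concat D g fun t => γ (t + (t₀ - D))) J := by
  have hjoin : g D = (fun t => γ (t + (t₀ - D))) D := by simp [hgD]
  have h1 : J ∩ Set.Iic D ⊆ Set.Icc 0 D := fun t ht => ⟨hJ0 ht.1, ht.2⟩
  have h2 : ∀ t ∈ J ∩ Set.Ici D, t + (t₀ - D) ∈ I := fun t ht => hJI t ht.1 ht.2
  refine ⟨continuousOn_concat hJ hjoin ((continuousOn_of_isometric hg).mono h1)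
    (hc.comp_add_const _ h2), ?_⟩
  rw [← zero_add (1 : ℝ)]
  refine isQuasiGeodesicOn_concat le_rfl zero_le_one hDJ hjoin
    (((isQuasiGeodesicOn_of_isometric hg).mono h1).weaken le_rfl (by norm_num) le_rfl)
    ((hq.comp_add_const _ h2).weaken (by norm_num) (by norm_num) zero_le_one) ?_
  intro s hs hsD t ht hDt
  have hs' : s ∈ Set.Icc 0 D := ⟨hJ0 hs, hsD⟩
  have ht' := hJI t ht hDt
  -- With δ the distance across the join, almost minimality gives D - s ≤ δ + 1, hence t - D ≤ 3 (2
  -- δ + 1) and t - s ≤ 7 δ + 4. This is the source of the constants 7 and 1.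
  have h3 := hmin _ ht'
  have h4 := dist_triangle o (g s) (γ (t + (t₀ - D)))
  have h5 := hg 0 ⟨le_rfl, hD0⟩ s hs'
  rw [hg0, zero_sub, abs_neg, abs_of_nonneg hs'.1] at h5
  have h6 := hg s hs' D ⟨hD0, le_rfl⟩
  rw [hgD, abs_sub_comm, abs_of_nonneg (sub_nonneg.2 hsD)] at h6
  have h7 := (hq _ ht₀ _ ht').1
  rw [show t₀ - (t + (t₀ - D)) = -(t - D) by ring, abs_neg,
    abs_of_nonneg (sub_nonneg.2 hDt)] at h7
  have h8 := dist_triangle_left (γ t₀) (γ (t + (t₀ - D))) (g s)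
  linarith

/-- Beyond the later of b and t₀ both images are the same tail of γ, and the rest is compact. -/
theorem asymptoticTo_concat {o : X} {γ : ℝ → X} {I : Set ℝ} (hI : I.OrdConnected)
    (hc : ContinuousOn γ I) (hunb : ¬ BddAbove I) {t₀ D b : ℝ} (hb : b ∈ I)
    (hD0 : 0 ≤ D) {g : ℝ → X} (hgD : g D = γ t₀)
    (hcc : ContinuousOn (concat D g fun t => γ (t + (t₀ - D))) (Set.Ici 0)) {η : Boundary X o}
    (h : AsymptoticTo (γ '' (I ∩ Set.Ici b)) η) :
    AsymptoticTo ((concat D g fun t => γ (t + (t₀ - D))) '' Set.Ici 0) η := by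
  have hjoin : g D = (fun t => γ (t + (t₀ - D))) D := by simp [hgD]
  obtain ⟨β, hβ, hd⟩ := h
  have hIci : ∀ a ∈ I, ∀ t, a ≤ t → t ∈ I := fun a ha t hat => by
    obtain ⟨i, hi, hti⟩ := not_bddAbove_iff.1 hunb t
    exact hI.out ha hi ⟨hat, hti.le⟩
  set m := max b t₀ with hm
  have hbm : b ≤ m := le_max_left _ _
  have htm : t₀ ≤ m := le_max_right _ _
  obtain ⟨C, -, hn⟩ : ∃ C, 0 ≤ C ∧ IsNear C
      ((concat D g fun t => γ (t + (t₀ - D))) '' Set.Ici 0) (γ '' (I ∩ Set.Ici b)) := by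
    refine exists_isNear_of_bounded_union ⟨_, 0, Set.self_mem_Ici, rfl⟩
      ⟨_, b, ⟨hb, Set.self_mem_Ici⟩, rfl⟩
      (S₀ := (concat D g fun t => γ (t + (t₀ - D))) '' Set.Icc 0 (m - (t₀ - D)))
      (T₀ := γ '' Set.Icc b m) (U := γ '' Set.Ici m)
      (isCompact_Icc.image_of_continuousOn (hcc.mono fun t ht => ht.1)).isBounded
      (isCompact_Icc.image_of_continuousOn (hc.mono fun t ht => hIci b hb t ht.1)).isBounded
      ?_ ?_ ?_ ?_
    · rintro _ ⟨t, ht, rfl⟩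
      rcases le_total t (m - (t₀ - D)) with h | h
      · exact Or.inl ⟨t, ⟨ht, h⟩, rfl⟩
      · refine Or.inr ⟨t + (t₀ - D), Set.mem_Ici.2 (by linarith), ?_⟩
        rw [concat_of_ge hjoin (by linarith)]
    · rintro _ ⟨t, ht, rfl⟩
      rcases le_total t m with h | h
      · exact Or.inl ⟨t, ⟨ht.2, h⟩, rfl⟩
      · exact Or.inr ⟨t, h, rfl⟩
    · rintro _ ⟨t, ht, rfl⟩
      have ht' : m ≤ t := ht
      refine ⟨t - (t₀ - D), Set.mem_Ici.2 (by linarith), ?_⟩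
      rw [concat_of_ge hjoin (by linarith), sub_add_cancel]
    · rintro _ ⟨t, ht, rfl⟩
      have ht' : b ≤ t := hbm.trans ht
      exact ⟨t, ⟨hIci b hb t ht', ht'⟩, rfl⟩
  exact ⟨β, hβ, ne_top_of_le_ne_top (ENNReal.add_ne_top.2 ⟨hn.hausdorffEDist_ne_top, hd⟩)
    Metric.hausdorffEDist_triangle⟩

/-- The path g followed by the right half of γ ends at y, so it is tested by the definition of Ū(η,
r) and passes near α^η(u). The lower bound `hD` forces this to happen on g. -/
theorem exists_dist_le_of_hasRightEndpoint [ProperSpace X] (hX : IsGeodesicSpace X) {o : X}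
    (η : Boundary X o) {r u : ℝ} (hu : 0 ≤ u) (hur : u ≤ r) {γ : ℝ → X} {I : Set ℝ}
    (hI : I.OrdConnected) (hc : ContinuousOn γ I) (hq : IsQuasiGeodesicOn 3 0 γ I)
    {y : Bordification X o} (hy : y ∈ bordNhd η r) (hend : HasRightEndpoint γ I y) {t₀ : ℝ}
    (ht₀ : t₀ ∈ I) (hmin : ∀ t ∈ I, dist o (γ t₀) ≤ dist o (γ t) + 1) {g : ℝ → X} (hg0 : g 0 = o)
    (hgD : g (dist o (γ t₀)) = γ t₀)
    (hg : ∀ s ∈ Set.Icc 0 (dist o (γ t₀)), ∀ t ∈ Set.Icc 0 (dist o (γ t₀)),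
      dist (g s) (g t) = |s - t|)
    (hD : u + fellowBound 7 1 (kappa (rhoOf η) 7 1 + 1) + 1 < dist o (γ t₀)) :
    ∃ v ∈ Set.Icc 0 (dist o (γ t₀)), dist (g v) ((geodesicRay η).toFun u) ≤
      fellowBound 7 1 (kappa (rhoOf η) 7 1 + 1) := by
  set D := dist o (γ t₀) with hDdef
  have hD0 : 0 ≤ D := dist_nonneg
  set c := concat D g fun t => γ (t + (t₀ - D)) with hcdef
  have hjoin : g D = (fun t => γ (t + (t₀ - D))) D := by simp [hgD]
  have hc0 : c 0 = o := by rw [hcdef, concat_of_le hD0, hg0]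
  have h7 : (1 : ℝ) ≤ 7 := by norm_num
  obtain ⟨J, hJ, hJ0, hJI, hJord, hcJ, hqJ, hset⟩ : ∃ J : Set ℝ, 0 ∈ J ∧ J ⊆ Set.Ici 0 ∧
      (∀ t ∈ J, D ≤ t → t + (t₀ - D) ∈ I) ∧ J.OrdConnected ∧ ContinuousOn c J ∧
      IsQuasiGeodesicOn 7 1 c J ∧
      setDist (c '' J) (farPart η r) ≤ ENNReal.ofReal (kappa (rhoOf η) 7 1) := by
    rcases hy with ⟨z, hz, rfl⟩ | ⟨θ, hθ, rfl⟩
    · obtain ⟨b, hb, hbz⟩ := hend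
      have htb : t₀ ≤ b := hb.2 ht₀
      have hJI : ∀ t ∈ Set.Icc 0 (b - (t₀ - D)), D ≤ t → t + (t₀ - D) ∈ I := fun t ht hDt =>
        hI.out ht₀ hb.1 ⟨by linarith, by linarith [ht.2]⟩
      obtain ⟨h1, h2⟩ := concat_closest_spec hc hq ht₀ hD0 hmin hg0 hgD hg isClosed_Icc
        (fun t ht => ht.1) ⟨hD0, by linarith⟩ hJI
      refine ⟨Set.Icc 0 (b - (t₀ - D)), ⟨le_rfl, by linarith⟩, fun t ht => ht.1, hJI, Set.ordConnected_Icc, h1, h2,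
        hz 7 1 h7 zero_le_one _ _ (by linarith) hc0 ?_ h1 h2⟩
      rw [hcdef, concat_of_ge hjoin (by linarith), sub_add_cancel, hbz]
    · obtain ⟨hunb, b, hb, has⟩ := hend
      have hJI : ∀ t ∈ Set.Ici (0 : ℝ), D ≤ t → t + (t₀ - D) ∈ I := fun t ht hDt => by
        obtain ⟨i, hi, hti⟩ := not_bddAbove_iff.1 hunb (t + (t₀ - D))
        exact hI.out ht₀ hi ⟨by linarith, hti.le⟩
      obtain ⟨h1, h2⟩ := concat_closest_spec hc hq ht₀ hD0 hmin hg0 hgD hg isClosed_Ici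
        subset_rfl hD0 hJI
      obtain ⟨β, hβ, hβθ⟩ := exists_ray hX h7 zero_le_one hc0 h1 h2
        (asymptoticTo_concat hI hc hunb hb hD0 hgD h1 has)
      have h3 := hθ 7 1 h7 zero_le_one β hβθ (hβ ▸ h1) (hβ ▸ h2)
      rw [Ray.image, hβ] at h3
      exact ⟨_, Set.self_mem_Ici, subset_rfl, hJI, Set.ordConnected_Ici, h1, h2, h3⟩
  obtain ⟨t, ht, hle⟩ := exists_dist_le_of_setDist_le hX η h7 le_rfl zero_le_one le_rfl hJord hJ
    hJ0 hc0 hcJ hqJ hu hur hset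
  -- After time D the path runs on γ, at distance at least D - 1 from o, too far from a point at
  -- height u.
  have htD : t ≤ D := by
    by_contra! hlt
    have h1 := hmin _ (hJI t ht hlt.le)
    rw [hcdef, concat_of_ge hjoin hlt.le] at hle
    have h2 := dist_triangle_right o (γ (t + (t₀ - D))) ((geodesicRay η).toFun u)
    rw [(geodesicRay_spec hX η).1.dist_base hu] at h2
    linarith
  rw [hcdef, concat_of_le htD] at hle
  exact ⟨t, ⟨hJ0 ht, htD⟩, hle⟩

/-- Time reversal transfers the estimate for right endpoints to left ones. -/
theorem HasLeftEndpoint.reverse {o : X} {γ : ℝ → X} {I : Set ℝ} {x : Bordification X o}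
    (h : HasLeftEndpoint γ I x) :
    HasRightEndpoint (fun t => γ (-t)) ((fun t => -t) ⁻¹' I) x := by
  cases x with
  | inner x =>
    obtain ⟨a, ha, hax⟩ := h
    refine ⟨-a, ⟨by simpa using ha.1, fun t ht => ?_⟩, by simpa using hax⟩
    linarith [ha.2 ht]
  | ideal ζ =>
    obtain ⟨hunb, a, ha, β, hβ, hd⟩ := h
    refine ⟨?_, -a, by simpa using ha, β, hβ, ?_⟩
    · rintro ⟨b, hb⟩
      refine hunb ⟨-b, fun t ht => ?_⟩
      have := hb (show -t ∈ (fun t => -t) ⁻¹' I by simpa using ht)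
      linarith
    · convert hd using 2
      ext z
      constructor
      · rintro ⟨t, ⟨ht, hta⟩, rfl⟩
        exact ⟨-t, ⟨ht, Set.mem_Iic.2 (by linarith [Set.mem_Ici.1 hta])⟩, rfl⟩
      · rintro ⟨t, ⟨ht, hta⟩, rfl⟩
        exact ⟨-t, ⟨by simpa using ht, by simpa using hta⟩, by simp⟩

theorem exists_dist_le_of_hasLeftEndpoint [ProperSpace X] (hX : IsGeodesicSpace X) {o : X}
    (ζ : Boundary X o) {r u : ℝ} (hu : 0 ≤ u) (hur : u ≤ r) {γ : ℝ → X} {I : Set ℝ}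
    (hI : I.OrdConnected) (hc : ContinuousOn γ I) (hq : IsQuasiGeodesicOn 3 0 γ I)
    {x : Bordification X o} (hx : x ∈ bordNhd ζ r) (hend : HasLeftEndpoint γ I x) {t₀ : ℝ}
    (ht₀ : t₀ ∈ I) (hmin : ∀ t ∈ I, dist o (γ t₀) ≤ dist o (γ t) + 1) {g : ℝ → X} (hg0 : g 0 = o)
    (hgD : g (dist o (γ t₀)) = γ t₀)
    (hg : ∀ s ∈ Set.Icc 0 (dist o (γ t₀)), ∀ t ∈ Set.Icc 0 (dist o (γ t₀)),
      dist (g s) (g t) = |s - t|)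
    (hD : u + fellowBound 7 1 (kappa (rhoOf ζ) 7 1 + 1) + 1 < dist o (γ t₀)) :
    ∃ v ∈ Set.Icc 0 (dist o (γ t₀)), dist (g v) ((geodesicRay ζ).toFun u) ≤
      fellowBound 7 1 (kappa (rhoOf ζ) 7 1 + 1) := by
  have h := exists_dist_le_of_hasRightEndpoint hX ζ hu hur (γ := fun t => γ (-t))
    (I := (fun t => -t) ⁻¹' I) (t₀ := -t₀) (g := g)
    ⟨fun s hs t ht v hv => hI.out ht hs ⟨neg_le_neg hv.2, neg_le_neg hv.1⟩⟩
    (hc.comp continuous_neg.continuousOn fun t ht => ht)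
    (fun s hs t ht => by
      have := hq _ hs _ ht
      rwa [neg_sub_neg, abs_sub_comm] at this)
    hx hend.reverse (by simpa using ht₀)
  simp only [neg_neg] at h
  exact h (fun t ht => hmin _ ht) hg0 hgD hg hD

/-! ### Distinct limits and the bounded set -/

theorem exists_dist_gt_of_ne [ProperSpace X] (hX : IsGeodesicSpace X) {o : X} {ζ η : Boundary X o}
    (h : ζ ≠ η) (C : ℝ) :
    ∃ u, 0 ≤ u ∧ C < dist ((geodesicRay ζ).toFun u) ((geodesicRay η).toFun u) := by
  by_contra! hle
  have hn : IsNear C (geodesicRay ζ).image (geodesicRay η).image := by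
    refine ⟨?_, ?_⟩
    · rintro _ ⟨t, ht, rfl⟩
      exact ⟨_, ⟨t, ht, rfl⟩, hle t ht⟩
    · rintro _ ⟨t, ht, rfl⟩
      exact ⟨_, ⟨t, ht, rfl⟩, by rw [dist_comm]; exact hle t ht⟩
  refine h ?_
  rw [← (geodesicRay_spec hX ζ).2, ← (geodesicRay_spec hX η).2]
  exact toBoundary_eq_iff.2 hn.hausdorffEDist_ne_top

/-- A quasi-geodesic with endpoints close to distinct boundary points passes near the base
point. -/
theorem exists_dist_le_of_ne [ProperSpace X] (hX : IsGeodesicSpace X) {o : X} {ζ η : Boundary X o}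
    (h : ζ ≠ η) : ∃ r R : ℝ, 1 ≤ r ∧ ∀ (γ : ℝ → X) (I : Set ℝ) (x y : Bordification X o),
      I.OrdConnected → I.Nonempty → ContinuousOn γ I → IsQuasiGeodesicOn 3 0 γ I →
      HasLeftEndpoint γ I x → HasRightEndpoint γ I y → x ∈ bordNhd ζ r → y ∈ bordNhd η r →
      ∃ t ∈ I, dist o (γ t) ≤ R := by
  set C := fellowBound 7 1 (kappa (rhoOf ζ) 7 1 + 1) with hC
  set D := fellowBound 7 1 (kappa (rhoOf η) 7 1 + 1) with hD
  -- The points g v and g w found below have parameters within C and D of u, so they are at most C +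
  -- D apart. Adding their distances C and D to the two rays gives 2 (C + D).
  obtain ⟨u, hu, hlt⟩ := exists_dist_gt_of_ne hX h (2 * (C + D))
  refine ⟨max 1 u, u + max C D + 1, le_max_left _ _, ?_⟩
  intro γ I x y hI hne hc hq hleft hright hx hy
  obtain ⟨_, ⟨t₀, ht₀, rfl⟩, hinf⟩ := exists_lt_of_csInf_lt (hne.image fun t => dist o (γ t))
    (lt_add_one _)
  have hmin : ∀ t ∈ I, dist o (γ t₀) ≤ dist o (γ t) + 1 := fun t ht => by
    have := csInf_le ⟨0, by rintro _ ⟨t, -, rfl⟩; exact dist_nonneg⟩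
      (Set.mem_image_of_mem (fun t => dist o (γ t)) ht)
    simp only at hinf this
    linarith
  refine ⟨t₀, ht₀, ?_⟩
  by_contra! hfar
  obtain ⟨g, hg0, hgD, hg⟩ := hX o (γ t₀)
  obtain ⟨v, hv, h1⟩ := exists_dist_le_of_hasLeftEndpoint hX ζ hu (le_max_right 1 u) hI hc hq hx
    hleft ht₀ hmin hg0 hgD hg (by linarith [le_max_left C D])
  obtain ⟨w, hw, h2⟩ := exists_dist_le_of_hasRightEndpoint hX η hu (le_max_right 1 u) hI hc hq hy
    hright ht₀ hmin hg0 hgD hg (by linarith [le_max_right C D])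
  have hbase : ∀ s ∈ Set.Icc 0 (dist o (γ t₀)), dist o (g s) = s := fun s hs => by
    have := hg 0 ⟨le_rfl, dist_nonneg⟩ s hs
    rwa [hg0, zero_sub, abs_neg, abs_of_nonneg hs.1] at this
  have hvu : |v - u| ≤ C := by
    have h3 := dist_triangle o (g v) ((geodesicRay ζ).toFun u)
    have h4 := dist_triangle_right o (g v) ((geodesicRay ζ).toFun u)
    rw [hbase v hv, (geodesicRay_spec hX ζ).1.dist_base hu] at h3 h4
    exact abs_sub_le_iff.2 ⟨by linarith, by linarith⟩
  have hwu : |w - u| ≤ D := by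
    have h3 := dist_triangle o (g w) ((geodesicRay η).toFun u)
    have h4 := dist_triangle_right o (g w) ((geodesicRay η).toFun u)
    rw [hbase w hw, (geodesicRay_spec hX η).1.dist_base hu] at h3 h4
    exact abs_sub_le_iff.2 ⟨by linarith, by linarith⟩
  have hvw : dist (g v) (g w) ≤ C + D := by
    rw [hg v hv w hw]
    have := abs_sub_le v u w
    rw [abs_sub_comm u w] at this
    linarith
  have h5 := dist_triangle4 ((geodesicRay ζ).toFun u) (g v) (g w) ((geodesicRay η).toFun u)
  rw [dist_comm _ (g v)] at h5
  linarith

theorem HasLeftEndpoint.nonempty {o : X} {γ : ℝ → X} {I : Set ℝ} {x : Bordification X o}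
    (h : HasLeftEndpoint γ I x) : I.Nonempty := by
  cases x with
  | inner x => exact ⟨_, h.choose_spec.1.1⟩
  | ideal ζ => exact ⟨_, h.2.choose_spec.1⟩

theorem image_ball_mem_nhds {o : X} (x : X) :
    Bordification.inner '' Metric.ball x 1 ∈ 𝓝 (Bordification.inner x : Bordification X o) := by
  refine IsOpen.mem_nhds ⟨?_, ?_⟩ ⟨x, Metric.mem_ball_self one_pos, rfl⟩
  · rintro y ⟨_, hy, ⟨⟩⟩
    have hy' : 0 < 1 - dist y x := sub_pos.2 (Metric.mem_ball.1 hy)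
    exact ⟨_, hy', Set.image_mono (Metric.ball_subset_ball' (by linarith))⟩
  · rintro _ ⟨y, hy, ⟨⟩⟩

/-- The finitely many paths not meeting the ball contribute one point each to B. -/
theorem exists_isBounded_of_eventually {o : X} {γ : ℕ → ℝ → X} {I : ℕ → Set ℝ}
    (hne : ∀ n, (I n).Nonempty) {R : ℝ} (h : ∀ᶠ n in atTop, ∃ t ∈ I n, dist o (γ n t) ≤ R) :
    ∃ B : Set X, Bornology.IsBounded B ∧ ∀ n, (γ n '' I n ∩ B).Nonempty := by
  obtain ⟨N, hN⟩ := eventually_atTop.1 h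
  choose t ht using hne
  refine ⟨Metric.closedBall o R ∪ (fun n => γ n (t n)) '' Set.Iio N,
    Metric.isBounded_closedBall.union ((Set.finite_Iio N).image _).isBounded, fun n => ?_⟩
  rcases lt_or_ge n N with hn | hn
  · exact ⟨_, ⟨t n, ht n, rfl⟩, Or.inr ⟨n, hn, rfl⟩⟩
  · obtain ⟨s, hs, hd⟩ := hN n hn
    exact ⟨_, ⟨s, hs, rfl⟩, Or.inl (by rwa [Metric.mem_closedBall, dist_comm])⟩

end MorseBoundary

theorem theorem4 {X : Type*} [MetricSpace X] [ProperSpace X]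
    (hX : MorseBoundary.IsGeodesicSpace X) (o : X)
    (I : ℕ → Set ℝ) (γ : ℕ → ℝ → X) (x y : ℕ → MorseBoundary.Bordification X o)
    (ζ η : MorseBoundary.Bordification X o)
    (hI : ∀ n, (I n).OrdConnected)
    (hcont : ∀ n, ContinuousOn (γ n) (I n))
    (hqg : ∀ n, MorseBoundary.IsQuasiGeodesicOn 3 0 (γ n) (I n))
    (hleft : ∀ n, MorseBoundary.HasLeftEndpoint (γ n) (I n) (x n))
    (hright : ∀ n, MorseBoundary.HasRightEndpoint (γ n) (I n) (y n))
    (hx : Tendsto x atTop (𝓝 ζ)) (hy : Tendsto y atTop (𝓝 η)) (hne : ζ ≠ η) :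
    ∃ B : Set X, Bornology.IsBounded B ∧ ∀ n, (γ n '' I n ∩ B).Nonempty := by
  have hnonempty := fun n => (hleft n).nonempty
  cases ζ with
  | inner p =>
    refine MorseBoundary.exists_isBounded_of_eventually hnonempty (o := p) (R := 1) ?_
    filter_upwards [hx (MorseBoundary.image_ball_mem_nhds p)] with n hn
    obtain ⟨z, hz, hzx⟩ := hn
    have hl := hleft n
    rw [← hzx] at hl
    obtain ⟨a, ha, rfl⟩ := hl
    exact ⟨a, ha.1, by rw [dist_comm]; exact (Metric.mem_ball.1 hz).le⟩
  | ideal ζ =>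
    cases η with
    | inner p =>
      refine MorseBoundary.exists_isBounded_of_eventually hnonempty (o := p) (R := 1) ?_
      filter_upwards [hy (MorseBoundary.image_ball_mem_nhds p)] with n hn
      obtain ⟨z, hz, hzy⟩ := hn
      have hr := hright n
      rw [← hzy] at hr
      obtain ⟨b, hb, rfl⟩ := hr
      exact ⟨b, hb.1, by rw [dist_comm]; exact (Metric.mem_ball.1 hz).le⟩
    | ideal η =>
      obtain ⟨r, R, hr, h⟩ := MorseBoundary.exists_dist_le_of_ne hX
        (show ζ ≠ η from fun h => hne (congrArg _ h))
      refine MorseBoundary.exists_isBounded_of_eventually hnonempty (o := o) (R := R) ?_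
      filter_upwards [hx (MorseBoundary.bordNhd_mem_nhds hX ζ hr),
        hy (MorseBoundary.bordNhd_mem_nhds hX η hr)] with n hxn hyn
      exact h _ _ _ _ (hI n) (hnonempty n) (hcont n) (hqg n) (hleft n) (hright n) hxn hyn
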